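/- Let $\tfrac12<\rho<2$, and for $a>0$ let $s_a:[0,\infty)\to\mathbb R$ be the scalar resolvent function, i.e. the unique continuous solution of $$s_a(t)+a\int_0^t \frac{(t-\tau)^{\rho-1}}{\Gamma(\rho)}\,s_a(\tau)\,d\tau=1,\qquad t\ge 0;$$ explicitly $s_a(t)=E_\rho(-a t^\rho)$, where $E_\rho(x)=\sum_{j\ge 0}x^j/\Gamma(\rho j+1)$ is the Mittag-Leffler function. Let $(\alpha_k)$ be a sequence of independent random variables on a probability space $(\bar\Omega,\bar{\mathcal F},\bar{\mathbb P})$, each with the Gamma distribution of density $\frac{1}{\Gamma(\mu)}\lambda e^{-\lambda x}(\lambda x)^{\mu-1}$, $x>0$, where $\mu,\lambda>0$. Let $W=(W(t))_{t\in\mathbb R}$ be a two-sided Wiener process on another probability space $(\Omega,\mathcal F,\mathbb P)$, i.e. $(W(t))_{t\ge0}$ and $(W(-t))_{t\ge0}$ are independent standard Brownian motions. For deterministic $h\in L^2(\mathbb R)$, the Wiener integral $\int_{\mathbb R} h\,dW$ is the $L^2(\mathbb P)$-limit of the integrals of step functions converging to $h$ in $L^2(\mathbb R)$. Then there is a constant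 $c>0$ depending only on $\rho$ such that, for every $a>0$, $s_a\in L^2(\mathbb R_+)$ and $$\|s_a\|^2_{L^2(\mathbb R_+)}\le c\,a^{-1/\rho}.$$ Moreover, $\bar{\mathbb P}$-almost surely, for every $k$: $\alpha_k>0$; the process $$\xi_k(t)=\int_{-\infty}^t s_{\alpha_k}(t-u)\,dW(u),\qquad t\in\mathbb R,$$ is well defined as a Wiener integral for each $t$ (up to modification); and (every version of) $\xi_k$ is, under $\mathbb P$, a (strictly) stationary Gaussian process with $\xi_k(t)\sim N\big(0,\|s_{\alpha_k}\|^2_{L^2(\mathbb R_+)}\big)$ for every $t\in\mathbb R$. -/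

import Mathlib

open MeasureTheory ProbabilityTheory Set Filter Topology
open scoped NNReal ENNReal

namespace FracOU

/-- The Mittag-Leffler function `E_ρ(x) = ∑ x ^ k / Γ(ρ k + 1)` on the real line. -/
noncomputable def mittagLeffler (ρ x : ℝ) : ℝ :=
  ∑' k : ℕ, x ^ k / Real.Gamma (ρ * k + 1)

/-- The fractional integration kernel `g_ρ(t) = t ^ (ρ - 1) / Γ(ρ)`, `t > 0`. -/
noncomputable def fracKernel (ρ t : ℝ) : ℝ :=
  t ^ (ρ - 1) / Real.Gamma ρ

/-- `s` is a continuous solution on `[0, ∞)` of the scalar resolvent equation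
`s(t) + a ∫₀ᵗ g_ρ(t - τ) s(τ) dτ = 1`. -/
def IsScalarResolvent (ρ a : ℝ) (s : ℝ → ℝ) : Prop :=
  ContinuousOn s (Ici 0) ∧
    ∀ t : ℝ, 0 ≤ t → s t + a * ∫ τ in (0 : ℝ)..t, fracKernel ρ (t - τ) * s τ = 1

/-- The scalar resolvent function `s_a(t) = E_ρ(-a t ^ ρ)`, `t ≥ 0` (its values for `t < 0` are
irrelevant). -/
noncomputable def scalarResolvent (ρ a t : ℝ) : ℝ :=
  mittagLeffler ρ (-(a * t ^ ρ))

/-- A two-sided Wiener process: `(W t)` and `(W (-t))`, `t ≥ 0`, are independent standard Brownian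
motions (with almost surely continuous paths). -/
structure IsTwoSidedWiener {Ω : Type*} [MeasurableSpace Ω] (W : ℝ → Ω → ℝ) (P : Measure Ω) :
    Prop where
  forward : IsBrownianReal (fun t : ℝ≥0 => W (t : ℝ)) P
  backward : IsBrownianReal (fun t : ℝ≥0 => W (-(t : ℝ))) P
  indep : IndepFun (fun ω (t : ℝ≥0) => W (t : ℝ) ω) (fun ω (t : ℝ≥0) => W (-(t : ℝ)) ω) P

/-- The data of a step function `∑ i, coeff i • 1_(left i, right i]` on the real line. -/
structure StepFn where
  n : ℕ
  left : Fin n → ℝ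
  right : Fin n → ℝ
  left_le_right : ∀ i, left i ≤ right i
  coeff : Fin n → ℝ

/-- The step function itself. -/
noncomputable def StepFn.toFun (φ : StepFn) (u : ℝ) : ℝ :=
  ∑ i, (Ioc (φ.left i) (φ.right i)).indicator (fun _ => φ.coeff i) u

/-- The integral of a step function against `W`: `∑ i, coeff i * (W (right i) - W (left i))`. -/
def StepFn.wienerIntegral {Ω : Type*} (φ : StepFn) (W : ℝ → Ω → ℝ) (ω : Ω) : ℝ :=
  ∑ i, φ.coeff i * (W (φ.right i) ω - W (φ.left i) ω)

/-- `X` is (a version of) the Wiener integral `∫ h(u) dW(u)` over the real line of the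
deterministic function `h ∈ L²(ℝ)`: the `L²(P)`-limit of the integrals of step functions that
converge to `h` in `L²(ℝ)`. -/
def IsWienerIntegral {Ω : Type*} [MeasurableSpace Ω] (W : ℝ → Ω → ℝ) (P : Measure Ω)
    (h : ℝ → ℝ) (X : Ω → ℝ) : Prop :=
  MemLp h 2 volume ∧ MemLp X 2 P ∧
    ∃ φ : ℕ → StepFn,
      Tendsto (fun m => eLpNorm (fun u => (φ m).toFun u - h u) 2 volume) atTop (𝓝 0) ∧
      Tendsto (fun m => eLpNorm (fun ω => (φ m).wienerIntegral W ω - X ω) 2 P) atTop (𝓝 0)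

/-- `ξ` is (a modification of) the process `ξ(t) = ∫_{-∞}^t s(t - u) dW(u)`, `t ∈ ℝ`. -/
def IsMovingAverage {Ω : Type*} [MeasurableSpace Ω] (W : ℝ → Ω → ℝ) (P : Measure Ω)
    (s : ℝ → ℝ) (ξ : ℝ → Ω → ℝ) : Prop :=
  ∀ t : ℝ, IsWienerIntegral W P ((Iic t).indicator fun u => s (t - u)) (ξ t)

/-- (Strict) stationarity: the finite-dimensional laws are invariant under time shifts. -/
def IsStationary {Ω : Type*} [MeasurableSpace Ω] (X : ℝ → Ω → ℝ) (P : Measure Ω) : Prop :=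
  ∀ (r : ℝ) (I : Finset ℝ),
    IdentDistrib (fun ω (t : I) => X (t + r) ω) (fun ω (t : I) => X t ω) P P

end FracOU

/-! The resolvent part rests on a comparison of the Mittag-Leffler series with a geometric one,
which follows from a super-exponential lower bound for Gamma. Integrating against the kernel shifts
the series by one index, which gives the equation; iterating the homogeneous equation bounds a
solution by the terms of the same series, which gives uniqueness.

For the L² bound, scaling reduces everything to a = 1. The Laplace transform is F(z) = z⁻¹(1 +
z^(-ρ))⁻¹. For ρ < 2 the values z^(-ρ), Re z > 0, stay in a sector away from -1, so F is holomorphic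
there and |F|² is bounded on vertical lines by an integrable function of Im z that does not depend
on the line; ρ > 1/2 is what makes it integrable near 0. Plancherel gives ∫ s² e^(-2σt) = ∫ |F(σ +
2πix)|² dx, but only for σ large, where s e^(-σt) is known to be integrable
(`integral_scalarResolvent_sq_mul_exp`). The right side continues holomorphically to Re σ > 0
(`differentiableAt_integral_vertical`), and since s² ≥ 0, a Landau-Pringsheim argument
(`lintegral_exp_eq_of_differentiableOn_ball`) carries the identity down to every σ > 0. Fatou as σ →
0 concludes.

The probabilistic part uses the closed span of the pairs (step function of t, W t) in L²(ℝ) × L²(P).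
Working with this graph makes linearity automatic and requires no well-definedness check. The
covariance of W makes the two components isometric, elements of the span are centred Gaussian, and
both facts pass to the closure. Density of the steps gives existence, and stationarity follows from
translation invariance of Lebesgue measure. -/

namespace FracOU

/-! ### Mittag-Leffler series: convergence, growth and scaling -/

/-- A lower bound for the Gamma function showing that it grows faster than any exponential. -/
lemma rpow_mul_exp_neg_le_Gamma {y R : ℝ} (hy : 0 ≤ y) (hR : 0 ≤ R) :
    R ^ y * Real.exp (-R) ≤ Real.Gamma (y + 1) := by
  have hint : IntegrableOn (fun x : ℝ => Real.exp (-x) * x ^ (y + 1 - 1)) (Ioi 0) :=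
    Real.GammaIntegral_convergent (by linarith)
  rw [Real.Gamma_eq_integral (by linarith), ← integral_exp_neg_Ioi R, ← integral_const_mul]
  -- On `(R, ∞)` the factor `x ^ y` is at least `R ^ y`; the rest of the Gamma integral is
  -- discarded.
  calc ∫ x in Ioi R, R ^ y * Real.exp (-x)
      ≤ ∫ x in Ioi R, Real.exp (-x) * x ^ (y + 1 - 1) := by
        refine setIntegral_mono_on ((integrableOn_exp_neg_Ioi R).const_mul _)
          (hint.mono_set (Ioi_subset_Ioi hR)) measurableSet_Ioi fun x hx => ?_
        rw [mul_comm, add_sub_cancel_right]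
        exact mul_le_mul_of_nonneg_left (Real.rpow_le_rpow hR (le_of_lt hx) hy)
          (Real.exp_pos _).le
    _ ≤ _ := by
        refine setIntegral_mono_set hint ?_ (Ioi_subset_Ioi hR).eventuallyLE
        filter_upwards [ae_restrict_mem measurableSet_Ioi] with x hx
        exact mul_nonneg (Real.exp_pos _).le (Real.rpow_nonneg (le_of_lt hx) _)

lemma Gamma_coeff_pos {ρ : ℝ} (hρ : 0 < ρ) (k : ℕ) : 0 < Real.Gamma (ρ * k + 1) :=
  Real.Gamma_pos_of_pos (by positivity)

/-- Domination of the terms of the Mittag-Leffler series by a geometric series. -/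
lemma abs_mittagLeffler_term_le {ρ : ℝ} (hρ : 0 < ρ) {x b q : ℝ} (hb : 0 ≤ b) (hq : 0 ≤ q)
    (hx : |x| ≤ b ^ ρ * q) (k : ℕ) :
    |x ^ k / Real.Gamma (ρ * k + 1)| ≤ Real.exp b * q ^ k := by
  have hG := Gamma_coeff_pos hρ k
  rw [abs_div, abs_of_pos hG, div_le_iff₀ hG, abs_pow]
  have h1 := rpow_mul_exp_neg_le_Gamma (y := ρ * k) (by positivity) hb
  rw [Real.rpow_mul hb, Real.rpow_natCast] at h1
  calc |x| ^ k ≤ (b ^ ρ * q) ^ k := by gcongr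
    _ = Real.exp b * q ^ k * ((b ^ ρ) ^ k * Real.exp (-b)) := by
        rw [mul_pow, Real.exp_neg]; field_simp
    _ ≤ _ := by gcongr

/-- Any bound on the argument can be written in the form that yields ratio 1/2 in the geometric
domination, so one `b` serves a whole ball. -/
lemma exists_rpow_mul_half_eq {ρ : ℝ} (hρ : 0 < ρ) {x : ℝ} (hx : 0 ≤ x) :
    ∃ b : ℝ, 0 ≤ b ∧ x = b ^ ρ * (1 / 2) := by
  refine ⟨(2 * x) ^ ρ⁻¹, by positivity, ?_⟩
  rw [← Real.rpow_mul (by positivity), inv_mul_cancel₀ hρ.ne', Real.rpow_one]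
  ring

lemma summable_abs_mittagLeffler_term {ρ : ℝ} (hρ : 0 < ρ) (x : ℝ) :
    Summable fun k : ℕ => |x ^ k / Real.Gamma (ρ * k + 1)| := by
  obtain ⟨b, hb, hx⟩ := exists_rpow_mul_half_eq hρ (abs_nonneg x)
  exact Summable.of_nonneg_of_le (fun _ => abs_nonneg _)
    (abs_mittagLeffler_term_le hρ hb (by norm_num) hx.le)
    (summable_geometric_two.mul_left _)

lemma hasSum_mittagLeffler {ρ : ℝ} (hρ : 0 < ρ) (x : ℝ) :
    HasSum (fun k : ℕ => x ^ k / Real.Gamma (ρ * k + 1)) (mittagLeffler ρ x) :=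
  (summable_abs_mittagLeffler_term hρ x).of_abs.hasSum

lemma abs_mittagLeffler_le {ρ : ℝ} (hρ : 0 < ρ) {x b : ℝ} (hb : 0 ≤ b)
    (hx : |x| ≤ b ^ ρ * (1 / 2)) : |mittagLeffler ρ x| ≤ 2 * Real.exp b := by
  have h := tsum_of_norm_bounded (f := fun k : ℕ => x ^ k / Real.Gamma (ρ * k + 1))
    (hasSum_geometric_two.mul_left (Real.exp b)) (abs_mittagLeffler_term_le hρ hb (by norm_num) hx)
  rw [mul_comm]
  exact h

lemma continuous_mittagLeffler {ρ : ℝ} (hρ : 0 < ρ) : Continuous (mittagLeffler ρ) := by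
  rw [continuous_iff_continuousAt]
  intro x
  obtain ⟨b, hb, hx⟩ := exists_rpow_mul_half_eq hρ (by positivity : (0 : ℝ) ≤ |x| + 1)
  have hc : ContinuousOn (mittagLeffler ρ) (Metric.ball 0 (|x| + 1)) :=
    continuousOn_tsum (fun k => by fun_prop)
      (summable_geometric_two.mul_left (Real.exp b))
      fun k y hy => abs_mittagLeffler_term_le hρ hb (by norm_num)
        (by rw [← hx]; simpa using (mem_ball_zero_iff.1 hy).le) k
  exact hc.continuousAt (Metric.isOpen_ball.mem_nhds (by simp))

lemma continuous_scalarResolvent {ρ : ℝ} (hρ : 0 < ρ) (a : ℝ) :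
    Continuous (scalarResolvent ρ a) :=
  (continuous_mittagLeffler hρ).comp
    ((Real.continuous_rpow_const hρ.le).const_mul a).neg

/-- Exponential bound for the scalar resolvent. -/
lemma abs_scalarResolvent_one_le {ρ : ℝ} (hρ : 0 < ρ) {t : ℝ} (ht : 0 ≤ t) :
    |scalarResolvent ρ 1 t| ≤ 2 * Real.exp (2 ^ ρ⁻¹ * t) := by
  -- With `b = 2 ^ ρ⁻¹ * t` the required inequality is an equality.
  refine abs_mittagLeffler_le hρ (by positivity) ?_
  rw [Real.mul_rpow (by positivity) ht, ← Real.rpow_mul (by norm_num), inv_mul_cancel₀ hρ.ne',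
    Real.rpow_one, one_mul, abs_neg, abs_of_nonneg (Real.rpow_nonneg ht _)]
  linarith

/-- Scaling of the scalar resolvent. -/
lemma scalarResolvent_eq_scale {ρ a t : ℝ} (hρ : 0 < ρ) (ha : 0 < a) (ht : 0 ≤ t) :
    scalarResolvent ρ a t = scalarResolvent ρ 1 (a ^ ρ⁻¹ * t) := by
  simp only [scalarResolvent]
  rw [Real.mul_rpow (by positivity) ht, ← Real.rpow_mul ha.le, inv_mul_cancel₀ hρ.ne',
    Real.rpow_one, one_mul]

/-! ### The resolvent equation: existence and uniqueness -/

lemma scalarResolvent_term {ρ a t : ℝ} (ht : 0 ≤ t) (k : ℕ) :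
    (-(a * t ^ ρ)) ^ k / Real.Gamma (ρ * k + 1) =
      (-a) ^ k / Real.Gamma (ρ * k + 1) * t ^ (ρ * k) := by
  rw [← neg_mul, mul_pow, Real.rpow_mul ht, Real.rpow_natCast]
  ring

lemma fracKernel_nonneg {ρ t : ℝ} (hρ : 0 < ρ) (ht : 0 ≤ t) : 0 ≤ fracKernel ρ t :=
  div_nonneg (Real.rpow_nonneg ht _) (Real.Gamma_pos_of_pos hρ).le

lemma intervalIntegrable_fracKernel {ρ : ℝ} (hρ : 0 < ρ) (t : ℝ) :
    IntervalIntegrable (fun τ => fracKernel ρ (t - τ)) volume 0 t := by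
  have h := ((intervalIntegral.intervalIntegrable_rpow' (r := ρ - 1) (by linarith)
    (a := 0) (b := t)).div_const (Real.Gamma ρ)).comp_sub_left t
  simpa [fracKernel] using h.symm

/-- Fractional integration of a power. -/
lemma integral_fracKernel_mul_rpow {ρ y t : ℝ} (hρ : 0 < ρ) (hy : 0 ≤ y) (ht : 0 ≤ t) :
    ∫ τ in (0 : ℝ)..t, fracKernel ρ (t - τ) * τ ^ y =
      t ^ (y + ρ) * (Real.Gamma (y + 1) / Real.Gamma (y + ρ + 1)) := by
  rcases ht.eq_or_lt with rfl | ht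
  · simp [Real.zero_rpow (by linarith : y + ρ ≠ 0)]
  have hG := Real.Gamma_pos_of_pos hρ
  -- This is the Beta integral B(y + 1, ρ) rescaled to `(0, t)`, read back from ℂ to ℝ.
  have hB := Complex.betaIntegral_scaled ((y + 1 : ℝ) : ℂ) (ρ : ℂ) ht
  rw [Complex.betaIntegral_eq_Gamma_mul_div _ _ (by simp; linarith) (by simpa)] at hB
  have hL : ∫ x in (0 : ℝ)..t, (x : ℂ) ^ (((y + 1 : ℝ) : ℂ) - 1) * ((t : ℂ) - x) ^ ((ρ : ℂ) - 1) =
      ((∫ x in (0 : ℝ)..t, x ^ y * (t - x) ^ (ρ - 1) : ℝ) : ℂ) := by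
    rw [← intervalIntegral.integral_ofReal]
    refine intervalIntegral.integral_congr fun x hx => ?_
    rw [uIcc_of_le ht.le] at hx
    simp only [Complex.ofReal_mul, Complex.ofReal_cpow hx.1,
      Complex.ofReal_cpow (sub_nonneg.2 hx.2)]
    push_cast
    congr 2
    ring
  rw [hL] at hB
  have hR : ((t : ℂ) ^ (((y + 1 : ℝ) : ℂ) + ρ - 1) * (Complex.Gamma ((y + 1 : ℝ) : ℂ) *
      Complex.Gamma ρ / Complex.Gamma (((y + 1 : ℝ) : ℂ) + ρ))) =
      ((t ^ (y + ρ) * (Real.Gamma (y + 1) * Real.Gamma ρ / Real.Gamma (y + ρ + 1)) : ℝ) : ℂ) := by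
    push_cast [Complex.ofReal_cpow ht.le, ← Complex.Gamma_ofReal]
    congr 2 <;> ring_nf
  rw [hR, Complex.ofReal_inj] at hB
  have : ∀ τ, fracKernel ρ (t - τ) * τ ^ y = (Real.Gamma ρ)⁻¹ * (τ ^ y * (t - τ) ^ (ρ - 1)) := by
    intro τ; simp only [fracKernel]; ring
  simp_rw [this]
  rw [intervalIntegral.integral_const_mul, hB]
  field_simp

/-- Fractional integration of a monomial of the Mittag-Leffler series. -/
lemma integral_fracKernel_mul_term {ρ t : ℝ} (hρ : 0 < ρ) (ht : 0 ≤ t) (c : ℝ) (k : ℕ) :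
    ∫ τ in (0 : ℝ)..t, fracKernel ρ (t - τ) * (c / Real.Gamma (ρ * k + 1) * τ ^ (ρ * k)) =
      c / Real.Gamma (ρ * (k + 1 : ℕ) + 1) * t ^ (ρ * (k + 1 : ℕ)) := by
  have hG := Gamma_coeff_pos hρ k
  have : ∀ τ : ℝ, fracKernel ρ (t - τ) * (c / Real.Gamma (ρ * k + 1) * τ ^ (ρ * k)) =
    c / Real.Gamma (ρ * k + 1) * (fracKernel ρ (t - τ) * τ ^ (ρ * k)) := fun τ => by ring
  simp_rw [this]
  rw [intervalIntegral.integral_const_mul, integral_fracKernel_mul_rpow hρ (by positivity) ht]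
  push_cast
  rw [mul_add, mul_one]
  field_simp

/-- The function `t ↦ E_ρ (-a t ^ ρ)` solves the scalar resolvent equation. -/
lemma scalarResolvent_equation {ρ a t : ℝ} (hρ : 0 < ρ) (ha : 0 < a) (ht : 0 ≤ t) :
    scalarResolvent ρ a t +
      a * ∫ τ in (0 : ℝ)..t, fracKernel ρ (t - τ) * scalarResolvent ρ a τ = 1 := by
  have hsum : HasSum (fun k : ℕ => ∫ τ in (0 : ℝ)..t, fracKernel ρ (t - τ) *
      ((-a) ^ k / Real.Gamma (ρ * k + 1) * τ ^ (ρ * k)))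
      (∫ τ in (0 : ℝ)..t, fracKernel ρ (t - τ) * scalarResolvent ρ a τ) := by
    -- Each term is monotone in τ up to sign, so its value at the endpoint `t` dominates it on `(0,
    -- t]`.
    refine intervalIntegral.hasSum_integral_of_dominated_convergence
      (fun k τ => fracKernel ρ (t - τ) * |(-(a * t ^ ρ)) ^ k / Real.Gamma (ρ * k + 1)|)
      (fun k => ?_) (fun k => ?_) ?_ ?_ ?_
    · refine (Measurable.aestronglyMeasurable ?_)
      unfold fracKernel
      fun_prop
    · refine ae_of_all _ fun τ hτ => ?_
      rw [uIoc_of_le ht] at hτ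
      rw [norm_mul, Real.norm_of_nonneg (fracKernel_nonneg hρ (sub_nonneg.2 hτ.2)),
        ← scalarResolvent_term hτ.1.le, Real.norm_eq_abs, abs_div, abs_div, abs_pow, abs_pow,
        abs_neg, abs_neg, abs_mul, abs_mul, abs_of_nonneg (Real.rpow_nonneg hτ.1.le _),
        abs_of_nonneg (Real.rpow_nonneg ht _)]
      have := hτ.1.le
      have := hτ.2
      have := fracKernel_nonneg hρ (sub_nonneg.2 hτ.2)
      gcongr
    · exact ae_of_all _ fun τ _ => (summable_abs_mittagLeffler_term hρ _).mul_left _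
    · simp_rw [tsum_mul_left]
      exact (intervalIntegrable_fracKernel hρ t).mul_const _
    · refine ae_of_all _ fun τ hτ => ?_
      rw [uIoc_of_le ht] at hτ
      simp_rw [← scalarResolvent_term hτ.1.le]
      exact (hasSum_mittagLeffler hρ _).mul_left _
  simp_rw [integral_fracKernel_mul_term hρ ht] at hsum
  -- The integrated series is the original one without its term `k = 0`, which equals 1.
  have h2 := (hasSum_nat_add_iff' 1).2 (hasSum_mittagLeffler hρ (-(a * t ^ ρ)))
  have h3 := hsum.mul_left (-a)
  have : (fun k : ℕ => -a * ((-a) ^ k / Real.Gamma (ρ * (k + 1 : ℕ) + 1) *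
      t ^ (ρ * (k + 1 : ℕ)))) = fun k : ℕ =>
      (-(a * t ^ ρ)) ^ (k + 1) / Real.Gamma (ρ * (k + 1 : ℕ) + 1) := by
    funext k
    rw [scalarResolvent_term ht, pow_succ]
    ring
  rw [this] at h3
  have h4 := h3.unique h2
  simp at h4
  simp only [scalarResolvent]
  simp only [scalarResolvent] at h4
  linarith

/-- Uniqueness for the homogeneous Volterra equation with the fractional kernel. -/
lemma eqOn_zero_of_fracKernel_volterra {ρ a : ℝ} (hρ : 0 < ρ) (ha : 0 < a) {d : ℝ → ℝ}
    (hd : ContinuousOn d (Ici 0))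
    (h : ∀ t : ℝ, 0 ≤ t → d t + a * ∫ τ in (0 : ℝ)..t, fracKernel ρ (t - τ) * d τ = 0) :
    EqOn d 0 (Ici 0) := by
  intro T hT
  obtain ⟨M, hM⟩ := (isCompact_Icc (a := (0 : ℝ)) (b := T)).exists_bound_of_continuousOn
    (hd.mono fun x hx => hx.1)
  have hM0 : 0 ≤ M := (norm_nonneg _).trans (hM T ⟨hT, le_rfl⟩)
  -- At `t = T` the bound is `M` times the absolute value of the n-th term of a convergent
  -- Mittag-Leffler series, hence tends to 0.
  have key : ∀ n : ℕ, ∀ t ∈ Icc 0 T,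
      |d t| ≤ M * a ^ n / Real.Gamma (ρ * n + 1) * t ^ (ρ * n) := by
    intro n
    induction n with
    | zero => intro t ht; simpa using hM t ht
    | succ n ih =>
      intro t ht
      have h1 : d t = -a * ∫ τ in (0 : ℝ)..t, fracKernel ρ (t - τ) * d τ := by
        linarith [h t ht.1]
      have h2 : ‖∫ τ in (0 : ℝ)..t, fracKernel ρ (t - τ) * d τ‖ ≤
          ∫ τ in (0 : ℝ)..t, fracKernel ρ (t - τ) *
            (M * a ^ n / Real.Gamma (ρ * n + 1) * τ ^ (ρ * n)) := by
        refine intervalIntegral.norm_integral_le_of_norm_le ht.1 (ae_of_all _ fun τ hτ => ?_) ?_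
        · have hk := fracKernel_nonneg hρ (sub_nonneg.2 hτ.2)
          rw [norm_mul, Real.norm_of_nonneg hk]
          exact mul_le_mul_of_nonneg_left (ih τ ⟨hτ.1.le, hτ.2.trans ht.2⟩) hk
        · refine (intervalIntegrable_fracKernel hρ t).mul_continuousOn ?_
          exact (continuous_const.mul
            (Real.continuous_rpow_const (by positivity))).continuousOn
      rw [integral_fracKernel_mul_term hρ ht.1] at h2
      rw [h1, abs_mul, abs_neg, abs_of_pos ha]
      calc a * |∫ τ in (0 : ℝ)..t, fracKernel ρ (t - τ) * d τ| ≤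
            a * (M * a ^ n / Real.Gamma (ρ * (n + 1 : ℕ) + 1) * t ^ (ρ * (n + 1 : ℕ))) :=
          mul_le_mul_of_nonneg_left h2 ha.le
        _ = _ := by rw [pow_succ]; ring
  have hlim := (summable_abs_mittagLeffler_term hρ (-(a * T ^ ρ))).tendsto_atTop_zero.const_mul M
  rw [mul_zero] at hlim
  have : |d T| ≤ 0 := by
    refine ge_of_tendsto' hlim fun n => (key n T ⟨hT, le_rfl⟩).trans (le_of_eq ?_)
    rw [abs_div, abs_of_pos (Gamma_coeff_pos hρ n), abs_pow, abs_neg,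
      abs_of_nonneg (mul_nonneg ha.le (Real.rpow_nonneg hT _)), mul_pow, Real.rpow_mul hT,
      Real.rpow_natCast]
    ring
  simpa using this

/-- The scalar resolvent equation has a unique continuous solution, given by the
Mittag-Leffler function. -/
theorem isScalarResolvent_iff {ρ a : ℝ} (hρ : 0 < ρ) (ha : 0 < a) (f : ℝ → ℝ) :
    IsScalarResolvent ρ a f ↔ EqOn f (scalarResolvent ρ a) (Ici 0) := by
  constructor
  · rintro ⟨hc, hf⟩
    have hs := continuous_scalarResolvent hρ a
    have h0 := eqOn_zero_of_fracKernel_volterra (d := fun t => f t - scalarResolvent ρ a t) hρ ha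
      (hc.sub hs.continuousOn) fun t ht => by
        have hsub : Icc 0 t ⊆ Ici 0 := fun x hx => hx.1
        have hi1 : IntervalIntegrable (fun τ => fracKernel ρ (t - τ) * f τ) volume 0 t :=
          (intervalIntegrable_fracKernel hρ t).mul_continuousOn
            (by rw [uIcc_of_le ht]; exact hc.mono hsub)
        have hi2 : IntervalIntegrable (fun τ => fracKernel ρ (t - τ) * scalarResolvent ρ a τ)
            volume 0 t :=
          (intervalIntegrable_fracKernel hρ t).mul_continuousOn hs.continuousOn
        simp_rw [mul_sub]
        rw [intervalIntegral.integral_sub hi1 hi2]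
        linarith [hf t ht, scalarResolvent_equation hρ ha ht]
    exact fun t ht => sub_eq_zero.1 (h0 ht)
  · intro h
    refine ⟨(continuous_scalarResolvent hρ a).continuousOn.congr h, fun t ht => ?_⟩
    rw [← scalarResolvent_equation hρ ha ht, h ht]
    congr 2
    refine intervalIntegral.integral_congr fun τ hτ => ?_
    rw [uIcc_of_le ht] at hτ
    simp only [h hτ.1]

/-! ### Analytic tools: positivity and continuation, Plancherel, Laplace transform of powers -/

/-- If the power series of an exponential integral of a measure on `[0, ∞)` agrees near `u` with a
function that is holomorphic on a disk around `u`, then the exponential integral is finite up to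
the right end of the disk and agrees with the holomorphic function there. -/
lemma lintegral_exp_eq_of_differentiableOn_ball {ν : Measure ℝ} (hν : ∀ᵐ t ∂ν, 0 ≤ t) {u r : ℝ}
    (hu : u ∈ interior (integrableExpSet id ν)) {H : ℂ → ℂ}
    (hH : DifferentiableOn ℂ H (Metric.ball (u : ℂ) r))
    (heq : ∀ᶠ x : ℝ in 𝓝 u, H x = mgf id ν x) {v : ℝ} (hv : 0 ≤ v) (hvr : v < r) :
    ∫⁻ t, ENNReal.ofReal (Real.exp ((u + v) * t)) ∂ν = ENNReal.ofReal (H (u + v : ℝ)).re := by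
  have hr : 0 < r := hv.trans_lt hvr
  have hHa : AnalyticAt ℂ H u :=
    hH.analyticAt (Metric.isOpen_ball.mem_nhds (Metric.mem_ball_self hr))
  have hMa : AnalyticAt ℂ (complexMGF id ν) u := analyticAt_complexMGF (by simpa using hu)
  -- Equality on real points, which accumulate at `u`, is enough by the identity theorem.
  have hev : H =ᶠ[𝓝 (u : ℂ)] complexMGF id ν := by
    refine (hHa.frequently_eq_iff_eventually_eq hMa).1 ?_
    have hreal : ∃ᶠ x : ℝ in 𝓝[≠] u, H x = complexMGF id ν x := by
      refine Eventually.frequently ?_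
      filter_upwards [heq.filter_mono nhdsWithin_le_nhds] with x hx
      rw [hx, complexMGF_ofReal]
    have hmap : Tendsto (fun x : ℝ => (x : ℂ)) (𝓝[≠] u) (𝓝[≠] (u : ℂ)) :=
      tendsto_nhdsWithin_iff.2 ⟨(Complex.continuous_ofReal.tendsto u).mono_left
        nhdsWithin_le_nhds, by
          filter_upwards [self_mem_nhdsWithin] with x hx
          simpa using hx⟩
    exact hmap.frequently hreal
  have hderiv : ∀ n : ℕ, iteratedDeriv n H u = ((∫ t, t ^ n * Real.exp (u * t) ∂ν : ℝ) : ℂ) := by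
    intro n
    rw [(hev.iteratedDeriv n).eq_of_nhds, iteratedDeriv_complexMGF (by simpa using hu),
      ← integral_complex_ofReal]
    simp
  -- The Taylor coefficients of `H` at `u` are moments of `exp (u t) ν`, and the series converges on
  -- the whole disk by holomorphy of `H` alone.
  have hT := Complex.hasSum_taylorSeries_on_ball hH (z := ((u + v : ℝ) : ℂ))
    (by simp [abs_of_nonneg hv, hvr])
  simp_rw [hderiv] at hT
  have hT' : HasSum (fun n : ℕ => ∫ t, v ^ n / n.factorial * (t ^ n * Real.exp (u * t)) ∂ν)
      (H (u + v : ℝ)).re := by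
    have := Complex.hasSum_re hT
    convert this using 2 with n
    rw [integral_const_mul]
    rw [← Complex.ofReal_re (v ^ n / n.factorial * ∫ t, t ^ n * Real.exp (u * t) ∂ν)]
    congr 1
    push_cast
    simp
    ring
  have hint : ∀ n : ℕ, Integrable (fun t => v ^ n / n.factorial * (t ^ n * Real.exp (u * t))) ν :=
    fun n => (integrable_pow_mul_exp_of_mem_interior_integrableExpSet hu n).const_mul _
  have hnn : ∀ n : ℕ, 0 ≤ᵐ[ν] fun t => v ^ n / n.factorial * (t ^ n * Real.exp (u * t)) := by
    intro n
    filter_upwards [hν] with t ht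
    simp only [Pi.zero_apply]
    positivity
  have hstep : ∫⁻ t, ENNReal.ofReal (Real.exp ((u + v) * t)) ∂ν =
      ∫⁻ t, ∑' n : ℕ, ENNReal.ofReal (v ^ n / n.factorial * (t ^ n * Real.exp (u * t))) ∂ν := by
    refine lintegral_congr_ae ?_
    filter_upwards [hν] with t ht
    have hs : HasSum (fun n : ℕ => v ^ n / n.factorial * (t ^ n * Real.exp (u * t)))
        (Real.exp ((u + v) * t)) := by
      have := (NormedSpace.expSeries_div_hasSum_exp (𝔸 := ℝ) (v * t)).mul_right (Real.exp (u * t))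
      rw [← Real.exp_eq_exp_ℝ, ← Real.exp_add, ← add_mul, add_comm v u] at this
      refine this.congr_fun fun n => ?_
      rw [mul_pow]; ring
    rw [← ENNReal.ofReal_tsum_of_nonneg (fun n => by positivity) hs.summable, hs.tsum_eq]
  -- All terms are nonnegative, so sum and integral are exchanged with no prior knowledge of
  -- finiteness at `u + v`.
  rw [hstep, lintegral_tsum fun n => (by fun_prop)]
  simp_rw [← ofReal_integral_eq_lintegral_ofReal (hint _) (hnn _)]
  rw [← ENNReal.ofReal_tsum_of_nonneg (fun n => integral_nonneg_of_ae (hnn n)) hT'.summable,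
    hT'.tsum_eq]

open scoped FourierTransform in
/-- Plancherel's theorem for an integrable function in `L²`. -/
lemma eLpNorm_fourier_eq {f : ℝ → ℂ} (hf : Integrable f) (hf2 : MemLp f 2)
    (hFf : MemLp (𝓕 f) 2) : eLpNorm (𝓕 f) 2 = eLpNorm f 2 := by
  -- The integral transform and the L² transform define the same tempered distribution, and L²
  -- embeds injectively into those.
  have key : 𝓕 (hf2.toLp f) = hFf.toLp (𝓕 f) := by
    have hinj : Function.Injective (Lp.toTemperedDistributionCLM (E := ℝ) ℂ (volume : Measure ℝ) 2) :=
      LinearMap.ker_eq_bot.1 (Lp.ker_toTemperedDistributionCLM_eq_bot (E := ℝ) (F := ℂ)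
        (μ := (volume : Measure ℝ)) (p := 2))
    apply hinj
    change Lp.toTemperedDistribution (𝓕 (hf2.toLp f)) = Lp.toTemperedDistribution (hFf.toLp (𝓕 f))
    rw [← Lp.fourier_toTemperedDistribution_eq]
    ext g
    rw [TemperedDistribution.fourier_apply, Lp.toTemperedDistribution_apply,
      Lp.toTemperedDistribution_apply]
    have h1 : ∫ x, (𝓕 g) x • (hf2.toLp f) x = ∫ x, f x • 𝓕 (g : ℝ → ℂ) x := by
      refine integral_congr_ae ?_
      filter_upwards [hf2.coeFn_toLp] with x hx
      rw [hx, smul_eq_mul, smul_eq_mul, mul_comm, SchwartzMap.fourier_coe]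
    have h2 : ∫ x, g x • (hFf.toLp (𝓕 f)) x = ∫ x, 𝓕 f x • g x := by
      refine integral_congr_ae ?_
      filter_upwards [hFf.coeFn_toLp] with x hx
      rw [hx, smul_eq_mul, smul_eq_mul, mul_comm]
    rw [h1, h2]
    have := VectorFourier.integral_fourierIntegral_smul_eq_flip (L := innerₗ ℝ)
      Real.continuous_fourierChar continuous_inner hf (g.integrable (μ := volume))
    rw [flip_innerₗ] at this
    exact this.symm
  have h := Lp.norm_fourier_eq (hf2.toLp f)
  rw [key, Lp.norm_toLp, Lp.norm_toLp] at h
  exact (ENNReal.toReal_eq_toReal_iff' hFf.2.ne hf2.2.ne).1 h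

/-- The Laplace transform of a power function on the right half-plane. -/
lemma integral_rpow_mul_cexp_neg_mul {y : ℝ} (hy : 0 ≤ y) {z : ℂ} (hz : 0 < z.re) :
    ∫ t in Ioi (0 : ℝ), ((t ^ y : ℝ) : ℂ) * Complex.exp (-z * t) =
      Real.Gamma (y + 1) * z ^ (-(y + 1) : ℂ) := by
  -- As a `complexMGF` the left side is holomorphic in `w = -z`; it matches the right side on the
  -- negative real axis by the real Gamma integral, hence on the half-plane.
  set ν : Measure ℝ := (volume.restrict (Ioi (0 : ℝ))).withDensity
    fun t => ENNReal.ofReal (t ^ y) with hν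
  have hmeas : Measurable fun t : ℝ => ENNReal.ofReal (t ^ y) := by fun_prop
  have hint : ∀ w : ℂ, complexMGF id ν w =
      ∫ t in Ioi (0 : ℝ), ((t ^ y : ℝ) : ℂ) * Complex.exp (w * t) := by
    intro w
    rw [complexMGF, hν, integral_withDensity_eq_integral_toReal_smul hmeas (by simp)]
    refine setIntegral_congr_fun measurableSet_Ioi fun t ht => ?_
    simp only [id, ENNReal.toReal_ofReal (Real.rpow_nonneg (le_of_lt ht) y), Complex.real_smul]
  have hset : Iio (0 : ℝ) ⊆ integrableExpSet id ν := by
    intro r hr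
    have hr' : 0 < -r := by simpa using hr
    change Integrable _ _
    rw [hν, integrable_withDensity_iff_integrable_smul' hmeas (by simp)]
    have := integrableOn_rpow_mul_exp_neg_mul_rpow (p := 1) (s := y) (b := -r) (by linarith)
      one_pos hr'
    refine this.congr_fun (fun t ht => ?_) measurableSet_Ioi
    simp [ENNReal.toReal_ofReal (Real.rpow_nonneg (le_of_lt ht) y)]
  have hint' : Iio (0 : ℝ) ⊆ interior (integrableExpSet id ν) :=
    interior_maximal hset isOpen_Iio
  have hU : IsOpen {w : ℂ | w.re < 0} := isOpen_lt Complex.continuous_re continuous_const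
  have hf : AnalyticOnNhd ℂ (complexMGF id ν) {w : ℂ | w.re < 0} := fun w hw =>
    analyticAt_complexMGF (hint' hw)
  have hg : AnalyticOnNhd ℂ (fun w : ℂ => Real.Gamma (y + 1) * (-w) ^ (-(y + 1) : ℂ))
      {w : ℂ | w.re < 0} := by
    refine DifferentiableOn.analyticOnNhd (fun w hw => ?_) hU
    refine (DifferentiableAt.const_mul ?_ _).differentiableWithinAt
    exact (differentiableAt_id.neg).cpow_const (Or.inl (by simpa using hw))
  have hpre : IsPreconnected {w : ℂ | w.re < 0} := (convex_halfSpace_re_lt 0).isPreconnected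
  have hfreq : ∃ᶠ w in 𝓝[≠] (-1 : ℂ),
      complexMGF id ν w = Real.Gamma (y + 1) * (-w) ^ (-(y + 1) : ℂ) := by
    have hmap : Tendsto (fun x : ℝ => (x : ℂ)) (𝓝[≠] (-1)) (𝓝[≠] (-1 : ℂ)) :=
      tendsto_nhdsWithin_iff.2 ⟨by
        simpa using (Complex.continuous_ofReal.tendsto (-1)).mono_left nhdsWithin_le_nhds, by
          filter_upwards [self_mem_nhdsWithin] with x hx
          intro h
          exact hx (Complex.ofReal_injective (by simpa using h))⟩
    refine hmap.frequently (Eventually.frequently ?_)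
    filter_upwards [nhdsWithin_le_nhds (Iio_mem_nhds (show (-1 : ℝ) < 0 by norm_num))] with x hx
    have hx' : 0 < -x := by simpa using hx
    have h := Real.integral_rpow_mul_exp_neg_mul_Ioi (a := y + 1) (by linarith) hx'
    have hval : complexMGF id ν x = ((∫ t in Ioi (0 : ℝ), t ^ (y + 1 - 1) *
        Real.exp (-(-x * t)) : ℝ) : ℂ) := by
      rw [hint, ← integral_complex_ofReal]
      simp
    rw [hval, h, one_div, Real.inv_rpow hx'.le, ← Real.rpow_neg hx'.le]
    push_cast [Complex.ofReal_cpow hx'.le]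
    ring
  have := hf.eqOn_of_preconnected_of_frequently_eq hg hpre (z₀ := -1) (by simp) hfreq
    (show (-z) ∈ {w : ℂ | w.re < 0} by simpa using hz)
  rw [← hint, this]
  simp

/-! ### The Laplace transform on the right half-plane: bounds and holomorphy -/

/-- The Laplace transform `z ^ (ρ - 1) / (z ^ ρ + 1)` of the scalar resolvent with `a = 1`. -/
noncomputable def resolventLaplace (ρ : ℝ) (z : ℂ) : ℂ :=
  z⁻¹ * (1 + z ^ (-(ρ : ℂ)))⁻¹

/-- Powers with exponent between `-2` and `0` map the right half-plane into a sector avoiding the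
negative real axis. -/
lemma exists_sector_bound {ρ : ℝ} (hρ : 0 < ρ) (hρ' : ρ < 2) :
    ∃ κ : ℝ, 0 < κ ∧ ∀ z : ℂ, 0 < z.re →
      κ * (1 + (‖z‖ ^ (-ρ)) ^ 2) ≤ ‖1 + z ^ (-(ρ : ℂ))‖ ^ 2 := by
  have hpi := Real.pi_pos
  -- The argument of z^(-ρ) is below πρ/2 < π in absolute value, so its cosine is at least `-m` with
  -- `m < 1`.
  set m : ℝ := max 0 (-Real.cos (Real.pi / 2 * ρ)) with hm
  have hm0 : 0 ≤ m := le_max_left _ _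
  have hlt : Real.cos Real.pi < Real.cos (Real.pi / 2 * ρ) :=
    Real.cos_lt_cos_of_nonneg_of_le_pi (by positivity) le_rfl (by nlinarith)
  rw [Real.cos_pi] at hlt
  have hm1 : m < 1 := max_lt one_pos (by linarith)
  refine ⟨1 - m, by linarith, fun z hz => ?_⟩
  have hz0 : z ≠ 0 := fun h => by simp [h] at hz
  have hr : 0 < ‖z‖ ^ (-ρ) := Real.rpow_pos_of_pos (norm_pos_iff.2 hz0) _
  set r := ‖z‖ ^ (-ρ) with hrdef
  have hcast : (-(ρ : ℂ)) = ((-ρ : ℝ) : ℂ) := by push_cast; rfl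
  have hnorm : ‖z ^ (-(ρ : ℂ))‖ = r := by rw [hcast, Complex.norm_cpow_real]
  have hre : (z ^ (-(ρ : ℂ))).re = r * Real.cos (z.arg * (-ρ)) := by
    rw [hcast, Complex.cpow_ofReal_re]
  have harg : |z.arg| < Real.pi / 2 := Complex.abs_arg_lt_pi_div_two_iff.2 (Or.inl hz)
  have hcos : -m ≤ Real.cos (z.arg * (-ρ)) := by
    rw [← Real.cos_abs, abs_mul, abs_neg, abs_of_pos hρ]
    have : Real.cos (Real.pi / 2 * ρ) ≤ Real.cos (|z.arg| * ρ) :=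
      Real.cos_le_cos_of_nonneg_of_le_pi (by positivity) (by nlinarith) (by gcongr)
    linarith [le_max_right 0 (-Real.cos (Real.pi / 2 * ρ))]
  have hexp : ‖1 + z ^ (-(ρ : ℂ))‖ ^ 2 = 1 + 2 * (r * Real.cos (z.arg * (-ρ))) + r ^ 2 := by
    rw [← hre, ← hnorm, Complex.sq_norm, Complex.sq_norm, Complex.normSq_apply,
      Complex.normSq_apply]
    simp
    ring
  rw [hexp]
  -- The identity used is 1 - 2mr + r² = (1 - m)(1 + r²) + m(1 - r)².
  nlinarith [mul_nonneg hm0 (sq_nonneg (1 - r)), mul_le_mul_of_nonneg_left hcos hr.le]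

/-- Bounds for the Laplace transform of the scalar resolvent. -/
lemma exists_resolventLaplace_bound {ρ : ℝ} (hρ : 0 < ρ) (hρ' : ρ < 2) :
    ∃ C : ℝ, 0 < C ∧ ∀ z : ℂ, 0 < z.re →
      1 + z ^ (-(ρ : ℂ)) ≠ 0 ∧ ‖resolventLaplace ρ z‖ ^ 2 ≤ C * ‖z‖ ^ (-2 : ℝ) ∧
        ‖resolventLaplace ρ z‖ ^ 2 ≤ C * ‖z‖ ^ (2 * min ρ 1 - 2) := by
  obtain ⟨κ, hκ, h⟩ := exists_sector_bound hρ hρ'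
  refine ⟨κ⁻¹, inv_pos.2 hκ, fun z hz => ?_⟩
  have hz0 : z ≠ 0 := fun h => by simp [h] at hz
  have hr : 0 < ‖z‖ := norm_pos_iff.2 hz0
  have hB := h z hz
  have hpos : 0 < κ * (1 + (‖z‖ ^ (-ρ)) ^ 2) := by positivity
  have hN : ‖resolventLaplace ρ z‖ ^ 2 ≤ ‖z‖ ^ (-2 : ℝ) * (κ * (1 + (‖z‖ ^ (-ρ)) ^ 2))⁻¹ := by
    rw [resolventLaplace, norm_mul, mul_pow, norm_inv, norm_inv, inv_pow, inv_pow,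
      Real.rpow_neg hr.le, Real.rpow_ofNat]
    gcongr
  refine ⟨fun h0 => ?_, hN.trans ?_, hN.trans ?_⟩
  · rw [h0] at hB
    simp at hB
    nlinarith [sq_nonneg (‖z‖ ^ (-ρ))]
  · rw [mul_comm]
    gcongr
    nlinarith [sq_nonneg (‖z‖ ^ (-ρ))]
  -- Capping ρ at 1 keeps the final exponent nonpositive, so that `‖z‖` can later be replaced by the
  -- smaller `|z.im|`.
  · have hkey : ‖z‖ ^ (-(2 * min ρ 1)) ≤ 1 + (‖z‖ ^ (-ρ)) ^ 2 := by
      rcases le_total 1 ‖z‖ with h1 | h1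
      · have : ‖z‖ ^ (-(2 * min ρ 1)) ≤ 1 :=
          Real.rpow_le_one_of_one_le_of_nonpos h1 (by have := lt_min hρ one_pos; linarith)
        nlinarith [sq_nonneg (‖z‖ ^ (-ρ))]
      · rw [← Real.rpow_natCast, ← Real.rpow_mul hr.le]
        have : ‖z‖ ^ (-(2 * min ρ 1)) ≤ ‖z‖ ^ (-ρ * (2 : ℕ)) :=
          Real.rpow_le_rpow_of_exponent_ge hr h1 (by
            push_cast
            linarith [min_le_left ρ 1])
        linarith
    have hp : 0 < ‖z‖ ^ (-(2 * min ρ 1)) := Real.rpow_pos_of_pos hr _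
    calc ‖z‖ ^ (-2 : ℝ) * (κ * (1 + (‖z‖ ^ (-ρ)) ^ 2))⁻¹
        ≤ ‖z‖ ^ (-2 : ℝ) * (κ * ‖z‖ ^ (-(2 * min ρ 1)))⁻¹ := by gcongr
      _ = κ⁻¹ * (‖z‖ ^ (-2 : ℝ) * ‖z‖ ^ (2 * min ρ 1)) := by
          rw [mul_inv, ← Real.rpow_neg hr.le, neg_neg]; ring
      _ = _ := by rw [← Real.rpow_add hr]; ring_nf

lemma differentiableOn_resolventLaplace {ρ : ℝ} (hρ : 0 < ρ) (hρ' : ρ < 2) :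
    DifferentiableOn ℂ (resolventLaplace ρ) {z | 0 < z.re} := by
  obtain ⟨C, -, h⟩ := exists_resolventLaplace_bound hρ hρ'
  intro z hz
  have hz0 : z ≠ 0 := fun h => by simp [h] at hz
  refine DifferentiableAt.differentiableWithinAt ?_
  exact (differentiableAt_inv hz0).mul
    (((differentiableAt_const _).add (differentiableAt_id.cpow_const (Or.inl hz))).inv (h z hz).1)

/-- The principal power commutes with conjugation off the negative axis. This turns |F(σ + ix)|²
into F(σ + ix) F(σ - ix), an expression holomorphic in σ. -/
lemma resolventLaplace_conj (ρ : ℝ) {z : ℂ} (hz : 0 < z.re) :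
    resolventLaplace ρ ((starRingEnd ℂ) z) = (starRingEnd ℂ) (resolventLaplace ρ z) := by
  have harg : z.arg ≠ Real.pi := by
    intro h
    have := Complex.abs_arg_lt_pi_div_two_iff.2 (Or.inl hz)
    rw [h, abs_of_pos Real.pi_pos] at this
    linarith [Real.pi_pos]
  simp only [resolventLaplace, map_mul, map_inv₀, map_add, map_one]
  rw [Complex.conj_cpow _ _ harg]
  simp

/-- The dominating function on vertical lines is integrable. -/
lemma integrable_min_rpow_abs {β : ℝ} (hβ : 1 / 2 < β) :
    Integrable fun ω : ℝ => min (|ω| ^ (-2 : ℝ)) (|ω| ^ (2 * β - 2)) := by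
  have hIoi : IntegrableOn (fun ω : ℝ => min (|ω| ^ (-2 : ℝ)) (|ω| ^ (2 * β - 2))) (Ioi 0) := by
    rw [← Ioc_union_Ioi_eq_Ioi zero_le_one]
    have hm : Measurable fun ω : ℝ => min (|ω| ^ (-2 : ℝ)) (|ω| ^ (2 * β - 2)) := by fun_prop
    refine IntegrableOn.union ?_ ?_
    -- The exponent exceeds -1 exactly because `β > 1 / 2`; with `β = min ρ 1` this is the lower
    -- bound on ρ.
    · have h1 : IntegrableOn (fun ω : ℝ => ω ^ (2 * β - 2)) (Ioc 0 1) :=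
        (intervalIntegrable_iff_integrableOn_Ioc_of_le zero_le_one).1
          (intervalIntegral.intervalIntegrable_rpow' (by linarith))
      refine h1.mono' hm.aestronglyMeasurable ?_
      filter_upwards [ae_restrict_mem measurableSet_Ioc] with x hx
      rw [Real.norm_of_nonneg (by positivity), abs_of_pos hx.1]
      exact min_le_right _ _
    · refine (integrableOn_Ioi_rpow_of_lt (a := -2) (by norm_num) one_pos).mono'
        hm.aestronglyMeasurable ?_
      filter_upwards [ae_restrict_mem measurableSet_Ioi] with x hx
      rw [Real.norm_of_nonneg (by positivity), abs_of_pos (one_pos.trans hx)]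
      exact min_le_left _ _
  have hIic : IntegrableOn (fun ω : ℝ => min (|ω| ^ (-2 : ℝ)) (|ω| ^ (2 * β - 2))) (Iic 0) := by
    rw [← Measure.map_neg_eq_self (volume : Measure ℝ)]
    let m : MeasurableEmbedding fun x : ℝ => -x := (Homeomorph.neg ℝ).measurableEmbedding
    rw [m.integrableOn_map_iff]
    simp_rw [Function.comp_def, abs_neg, neg_preimage, neg_Iic, neg_zero]
    exact Iff.mpr integrableOn_Ici_iff_integrableOn_Ioi hIoi
  have := hIic.union hIoi
  rwa [Iic_union_Ioi, integrableOn_univ] at this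

/-- Since both exponents are nonpositive and `|z.im| ≤ ‖z‖`, the bound no longer sees the real part:
it is uniform over vertical lines. -/
lemma norm_sq_resolventLaplace_le {ρ C : ℝ} {z : ℂ}
    (h1 : ‖resolventLaplace ρ z‖ ^ 2 ≤ C * ‖z‖ ^ (-2 : ℝ))
    (h2 : ‖resolventLaplace ρ z‖ ^ 2 ≤ C * ‖z‖ ^ (2 * min ρ 1 - 2)) (hC : 0 < C)
    (hz : z.im ≠ 0) :
    ‖resolventLaplace ρ z‖ ^ 2 ≤
      C * min (|z.im| ^ (-2 : ℝ)) (|z.im| ^ (2 * min ρ 1 - 2)) := by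
  have hi : 0 < |z.im| := abs_pos.2 hz
  have hle := Complex.abs_im_le_norm z
  rw [mul_min_of_nonneg _ _ hC.le, le_min_iff]
  refine ⟨h1.trans ?_, h2.trans ?_⟩ <;> refine mul_le_mul_of_nonneg_left ?_ hC.le
  · exact Real.rpow_le_rpow_of_nonpos hi hle (by norm_num)
  · exact Real.rpow_le_rpow_of_nonpos hi hle (by linarith [min_le_right ρ 1])

/-- The real part keeps the point away from 0 when `x` is small, and `|x|` dominates when it is
large; the constant is uniform for `s` in a small ball. -/
lemma vertical_norm_bound {s : ℂ} {δ M : ℝ} (hδ : 0 < δ) (hs : δ ≤ s.re) (hM : ‖s‖ ≤ M) (x : ℝ) :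
    (1 + |x|) ≤ (1 + (1 + M) / δ) * ‖s + x * Complex.I‖ := by
  have h1 : δ ≤ ‖s + x * Complex.I‖ := by
    have := Complex.re_le_norm (s + x * Complex.I)
    simp at this
    linarith
  have h2 : |x| ≤ ‖s + x * Complex.I‖ + M := by
    have : ‖(x : ℂ) * Complex.I‖ ≤ ‖s + x * Complex.I‖ + ‖s‖ := by
      have := norm_sub_le (s + x * Complex.I) s
      rwa [add_sub_cancel_left] at this
    simp at this
    linarith
  have hM0 : 0 ≤ M := (norm_nonneg _).trans hM
  have h3 : (1 + M) ≤ (1 + M) / δ * ‖s + x * Complex.I‖ := by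
    rw [div_mul_eq_mul_div, le_div_iff₀ hδ]
    gcongr
  nlinarith

/-- Analytic continuation of the energy integral: if `F` is holomorphic with `‖F z‖ ≤ C / ‖z‖` on
the right half-plane, then `s ↦ ∫ F (s + ix) F (s - ix) dx` is holomorphic there. -/
lemma differentiableAt_integral_vertical {F : ℂ → ℂ} {C : ℝ}
    (hF : DifferentiableOn ℂ F {z | 0 < z.re}) (hC : ∀ z : ℂ, 0 < z.re → ‖F z‖ ≤ C * ‖z‖⁻¹)
    {s₀ : ℂ} (hs₀ : 0 < s₀.re) :
    DifferentiableAt ℂ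
      (fun s : ℂ => ∫ x : ℝ, F (s + x * Complex.I) * F (s - x * Complex.I)) s₀ := by
  have hU : IsOpen {z : ℂ | 0 < z.re} := isOpen_lt continuous_const Complex.continuous_re
  have hC0 : 0 ≤ C := by
    have := (norm_nonneg _).trans (hC 1 (by simp))
    simpa using this
  set δ : ℝ := s₀.re / 2 with hδdef
  have hδ : 0 < δ := by positivity
  set M : ℝ := ‖s₀‖ + δ with hMdef
  set K : ℝ := 1 + (1 + M) / δ with hK
  have hK0 : 0 < K := by positivity
  have hball : ∀ s ∈ Metric.ball s₀ δ, δ ≤ s.re ∧ ‖s‖ ≤ M := by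
    intro s hs
    rw [mem_ball_iff_norm] at hs
    constructor
    · have := (Complex.abs_re_le_norm (s - s₀)).trans hs.le
      rw [Complex.sub_re] at this
      have := (abs_le.1 this).1
      linarith
    · have := norm_add_le s₀ (s - s₀)
      rw [add_sub_cancel] at this
      linarith
  have hre : ∀ (s : ℂ) (x : ℝ), (s + x * Complex.I).re = s.re := by intro s x; simp
  have hinv : ∀ s ∈ Metric.ball s₀ δ, ∀ x : ℝ, ‖s + x * Complex.I‖⁻¹ ≤ K * (1 + |x|)⁻¹ := by
    intro s hs x
    have h1 := vertical_norm_bound hδ (hball s hs).1 (hball s hs).2 x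
    have hpos : 0 < 1 + |x| := by positivity
    have hw : 0 < ‖s + x * Complex.I‖ := by
      by_contra h
      have : ‖s + x * Complex.I‖ = 0 := le_antisymm (not_lt.1 h) (norm_nonneg _)
      rw [this] at h1
      linarith
    rw [← div_eq_mul_inv, inv_eq_one_div, div_le_div_iff₀ hw hpos]
    linarith
  have hFb : ∀ s ∈ Metric.ball s₀ δ, ∀ x : ℝ,
      ‖F (s + x * Complex.I)‖ ≤ C * K * (1 + |x|)⁻¹ := by
    intro s hs x
    refine (hC _ (by rw [hre]; linarith [(hball s hs).1])).trans ?_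
    rw [mul_assoc]
    exact mul_le_mul_of_nonneg_left (hinv s hs x) hC0
  -- Cauchy's estimate on the circle of radius `δ / 2`, which stays in the half-plane and on which
  -- `‖w‖ ≥ ‖z‖ / 2`: the derivative decays like `F` itself.
  have hdF : ∀ z : ℂ, δ ≤ z.re → ‖deriv F z‖ ≤ C * (2 * ‖z‖⁻¹) / (δ / 2) := by
    intro z hz
    have hzn : δ ≤ ‖z‖ := hz.trans (Complex.re_le_norm z)
    have hsub : ∀ w ∈ Metric.closedBall z (δ / 2), 0 < w.re ∧ ‖z‖ / 2 ≤ ‖w‖ := by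
      intro w hw
      rw [mem_closedBall_iff_norm] at hw
      constructor
      · have := (Complex.abs_re_le_norm (w - z)).trans hw
        rw [Complex.sub_re] at this
        have := (abs_le.1 this).1
        linarith
      · have := norm_sub_norm_le z w
        rw [norm_sub_rev] at this
        linarith
    refine Complex.norm_deriv_le_of_forall_mem_sphere_norm_le (by positivity) ?_ fun w hw => ?_
    · exact DifferentiableOn.diffContOnCl_ball (U := {z : ℂ | 0 < z.re}) hF
        fun w hw => (hsub w hw).1
    · have := hsub w (Metric.sphere_subset_closedBall hw)
      refine (hC w this.1).trans (mul_le_mul_of_nonneg_left ?_ hC0)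
      rw [← inv_inv (2 : ℝ), ← mul_inv]
      exact inv_anti₀ (by linarith) (by linarith)
  have hdFb : ∀ s ∈ Metric.ball s₀ δ, ∀ x : ℝ,
      ‖deriv F (s + x * Complex.I)‖ ≤ 4 * C * K / δ * (1 + |x|)⁻¹ := by
    intro s hs x
    refine (hdF _ (by rw [hre]; exact (hball s hs).1)).trans ?_
    have := mul_le_mul_of_nonneg_left (hinv s hs x) (by positivity : 0 ≤ 4 * C / δ)
    calc _ = 4 * C / δ * ‖s + x * Complex.I‖⁻¹ := by field_simp; ring
      _ ≤ _ := this
      _ = _ := by ring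
  have hneg : ∀ (s : ℂ) (x : ℝ), s - x * Complex.I = s + (-x : ℝ) * Complex.I := by
    intro s x; push_cast; ring
  have hder : ∀ s ∈ Metric.ball s₀ δ, ∀ x : ℝ, HasDerivAt (fun w : ℂ => F (w + x * Complex.I))
      (deriv F (s + x * Complex.I)) s := by
    intro s hs x
    have hmem : (s + x * Complex.I) ∈ {z : ℂ | 0 < z.re} := by
      rw [mem_ofPred_eq, hre]; linarith [(hball s hs).1]
    have h1 := (hF.differentiableAt (hU.mem_nhds hmem)).hasDerivAt
    exact h1.comp_add_const s (x * Complex.I)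
  have hcont : ∀ s ∈ Metric.ball s₀ δ, Continuous fun x : ℝ => F (s + x * Complex.I) := by
    intro s hs
    refine hF.continuousOn.comp_continuous (by fun_prop) fun x => ?_
    rw [mem_ofPred_eq, hre]; linarith [(hball s hs).1]
  have hcontm : ∀ s ∈ Metric.ball s₀ δ, Continuous fun x : ℝ =>
      F (s + x * Complex.I) * F (s - x * Complex.I) := by
    intro s hs
    simp_rw [hneg]
    exact (hcont s hs).mul ((hcont s hs).comp continuous_neg)
  have hs0 : s₀ ∈ Metric.ball s₀ δ := Metric.mem_ball_self hδ
  have hsq : ∀ x : ℝ, (1 + |x|)⁻¹ * (1 + |x|)⁻¹ ≤ (1 + x ^ 2)⁻¹ := by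
    intro x
    rw [← mul_inv]
    refine inv_anti₀ (by positivity) ?_
    nlinarith [abs_nonneg x, sq_abs x]
  have hbound : ∀ A B : ℝ, 0 ≤ A → 0 ≤ B → ∀ x p q : ℝ, 0 ≤ q →
      p ≤ A * (1 + |x|)⁻¹ → q ≤ B * (1 + |x|)⁻¹ → p * q ≤ A * B * (1 + x ^ 2)⁻¹ := by
    intro A B hA hB x p q hq hp hqB
    calc p * q ≤ (A * (1 + |x|)⁻¹) * (B * (1 + |x|)⁻¹) := by gcongr
      _ = A * B * ((1 + |x|)⁻¹ * (1 + |x|)⁻¹) := by ring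
      _ ≤ _ := mul_le_mul_of_nonneg_left (hsq x) (by positivity)
  refine (hasDerivAt_integral_of_dominated_loc_of_deriv_le (μ := volume)
    (F := fun (s : ℂ) (x : ℝ) => F (s + x * Complex.I) * F (s - x * Complex.I))
    (F' := fun (s : ℂ) (x : ℝ) => deriv F (s + x * Complex.I) * F (s + (-x : ℝ) * Complex.I) +
      F (s + x * Complex.I) * deriv F (s + (-x : ℝ) * Complex.I))
    (bound := fun x => (4 * C * K / δ * (C * K) + C * K * (4 * C * K / δ)) * (1 + x ^ 2)⁻¹)
    (Metric.ball_mem_nhds s₀ hδ) ?_ ?_ ?_ ?_ ?_ ?_).2.differentiableAt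
  · filter_upwards [Metric.ball_mem_nhds s₀ hδ] with s hs
    exact (hcontm s hs).aestronglyMeasurable
  · refine (integrable_inv_one_add_sq.const_mul (C * K * (C * K))).mono'
      (hcontm s₀ hs0).aestronglyMeasurable (ae_of_all _ fun x => ?_)
    rw [norm_mul, hneg]
    refine hbound _ _ (by positivity) (by positivity) x _ _ (norm_nonneg _) (hFb _ hs0 x) ?_
    simpa using hFb _ hs0 (-x)
  · have h1 : Measurable fun x : ℝ => deriv F (s₀ + x * Complex.I) :=
      (measurable_deriv F).comp (by fun_prop)
    have h2 : Measurable fun x : ℝ => F (s₀ + x * Complex.I) := (hcont s₀ hs0).measurable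
    exact ((h1.mul (h2.comp measurable_neg)).add
      (h2.mul (h1.comp measurable_neg))).aestronglyMeasurable
  · refine ae_of_all _ fun x s hs => ?_
    rw [add_mul]
    refine (norm_add_le _ _).trans (add_le_add ?_ ?_) <;> rw [norm_mul]
    · refine hbound _ _ (by positivity) (by positivity) x _ _ (norm_nonneg _) (hdFb _ hs x) ?_
      simpa using hFb _ hs (-x)
    · refine hbound _ _ (by positivity) (by positivity) x _ _ (norm_nonneg _) (hFb _ hs x) ?_
      simpa using hdFb _ hs (-x)
  · exact integrable_inv_one_add_sq.const_mul _
  · refine ae_of_all _ fun x s hs => ?_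
    simp_rw [hneg]
    exact (hder s hs x).mul (hder s hs (-x))

/-! ### The energy identity and square integrability -/

lemma integrableOn_scalarResolvent_mul_exp {ρ σ : ℝ} (hρ : 0 < ρ) (hσ : 2 ^ ρ⁻¹ < σ) :
    IntegrableOn (fun t => scalarResolvent ρ 1 t * Real.exp (-σ * t)) (Ioi 0) := by
  have h := (integrableOn_exp_mul_Ioi (a := 2 ^ ρ⁻¹ - σ) (by linarith) 0).const_mul 2
  refine h.mono' ?_ ?_
  · exact ((continuous_scalarResolvent hρ 1).mul (by fun_prop)).aestronglyMeasurable
  · filter_upwards [ae_restrict_mem measurableSet_Ioi] with t ht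
    rw [norm_mul, Real.norm_of_nonneg (Real.exp_pos _).le, sub_mul, sub_eq_add_neg, Real.exp_add,
      ← mul_assoc, ← neg_mul]
    exact mul_le_mul_of_nonneg_right (abs_scalarResolvent_one_le hρ (le_of_lt ht))
      (Real.exp_pos _).le

lemma integrableOn_scalarResolvent_sq_mul_exp {ρ σ : ℝ} (hρ : 0 < ρ) (hσ : 2 ^ ρ⁻¹ < σ) :
    IntegrableOn (fun t => scalarResolvent ρ 1 t ^ 2 * Real.exp (-2 * σ * t)) (Ioi 0) := by
  have h := (integrableOn_exp_mul_Ioi (a := 2 * (2 ^ ρ⁻¹ - σ)) (by linarith) 0).const_mul 4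
  refine h.mono' ?_ ?_
  · exact (((continuous_scalarResolvent hρ 1).pow 2).mul (by fun_prop)).aestronglyMeasurable
  · filter_upwards [ae_restrict_mem measurableSet_Ioi] with t ht
    rw [Real.norm_of_nonneg (by positivity), ← sq_abs]
    calc |scalarResolvent ρ 1 t| ^ 2 * Real.exp (-2 * σ * t)
        ≤ (2 * Real.exp (2 ^ ρ⁻¹ * t)) ^ 2 * Real.exp (-2 * σ * t) := by
          gcongr
          exact abs_scalarResolvent_one_le hρ (le_of_lt ht)
      _ = 4 * (Real.exp (2 ^ ρ⁻¹ * t) * Real.exp (2 ^ ρ⁻¹ * t) * Real.exp (-2 * σ * t)) := by ring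
      _ = _ := by rw [← Real.exp_add, ← Real.exp_add]; ring_nf

/-- The Laplace transform of the scalar resolvent with `a = 1`. -/
lemma laplace_scalarResolvent {ρ : ℝ} (hρ : 0 < ρ) {z : ℂ} (hz : 1 < z.re) :
    ∫ t in Ioi (0 : ℝ), (scalarResolvent ρ 1 t : ℂ) * Complex.exp (-z * t) =
      resolventLaplace ρ z := by
  have hz0 : 0 < z.re := by linarith
  have hzne : z ≠ 0 := fun h => by simp [h] at hz0
  have hzn : 1 < ‖z‖ := hz.trans_le (Complex.re_le_norm z)
  set F : ℕ → ℝ → ℂ := fun k t =>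
    ((-1) ^ k / Real.Gamma (ρ * k + 1) : ℝ) * (((t ^ (ρ * k) : ℝ) : ℂ) * Complex.exp (-z * t))
    with hF
  have hnorm : ∀ k : ℕ, ∀ t ∈ Ioi (0 : ℝ), ‖F k t‖ =
      (Real.Gamma (ρ * k + 1))⁻¹ * (t ^ (ρ * k + 1 - 1) * Real.exp (-(z.re * t))) := by
    intro k t ht
    have hG := Gamma_coeff_pos hρ k
    simp only [hF, norm_mul, Complex.norm_real, Complex.norm_exp]
    rw [norm_div, norm_pow, norm_neg, norm_one, one_pow, Real.norm_of_nonneg hG.le, one_div,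
      Real.norm_of_nonneg (Real.rpow_nonneg (le_of_lt ht) _), add_sub_cancel_right]
    simp
  have hint0 : ∀ k : ℕ, IntegrableOn
      (fun t : ℝ => t ^ (ρ * k + 1 - 1) * Real.exp (-(z.re * t))) (Ioi 0) := by
    intro k
    have := integrableOn_rpow_mul_exp_neg_mul_rpow (p := 1) (s := ρ * k) (b := z.re)
      (by have : 0 ≤ ρ * k := by positivity
          linarith) one_pos hz0
    simpa using this
  have hint : ∀ k, Integrable (F k) (volume.restrict (Ioi 0)) := by
    intro k
    refine ((hint0 k).const_mul (Real.Gamma (ρ * k + 1))⁻¹).mono' ?_ ?_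
    · refine Measurable.aestronglyMeasurable ?_
      simp only [hF]
      fun_prop
    · filter_upwards [ae_restrict_mem measurableSet_Ioi] with t ht
      exact (hnorm k t ht).le
  have hnint : ∀ k : ℕ, ∫ t in Ioi (0 : ℝ), ‖F k t‖ = z.re⁻¹ * ((z.re ^ ρ)⁻¹) ^ k := by
    intro k
    have hG := Gamma_coeff_pos hρ k
    rw [setIntegral_congr_fun measurableSet_Ioi (hnorm k), integral_const_mul,
      Real.integral_rpow_mul_exp_neg_mul_Ioi (by positivity) hz0, one_div,
      Real.inv_rpow hz0.le, Real.rpow_add hz0, Real.rpow_one, Real.rpow_mul hz0.le,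
      Real.rpow_natCast, inv_pow]
    field_simp
  -- The L¹ norms of the terms form a geometric series with this ratio, which is why `1 < z.re` is
  -- assumed.
  have hgeom : (z.re ^ ρ)⁻¹ < 1 := inv_lt_one_of_one_lt₀ (Real.one_lt_rpow hz hρ)
  have hsum : Summable fun k => ∫ t in Ioi (0 : ℝ), ‖F k t‖ := by
    simp_rw [hnint]
    exact (summable_geometric_of_lt_one (by positivity) hgeom).mul_left _
  have hS := hasSum_integral_of_summable_integral_norm hint hsum
  have hval : ∀ k : ℕ, ∫ t in Ioi (0 : ℝ), F k t = z⁻¹ * (-(z ^ (-(ρ : ℂ)))) ^ k := by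
    intro k
    have hG : (Real.Gamma (ρ * k + 1) : ℂ) ≠ 0 := by exact_mod_cast (Gamma_coeff_pos hρ k).ne'
    simp only [hF]
    rw [integral_const_mul, integral_rpow_mul_cexp_neg_mul (by positivity) hz0, neg_add,
      Complex.cpow_add _ _ hzne, Complex.cpow_neg_one, neg_pow (z ^ (-(ρ : ℂ))) k,
      ← Complex.cpow_nat_mul]
    push_cast
    rw [show (k : ℂ) * -(ρ : ℂ) = -((ρ : ℂ) * k) by ring]
    field_simp
  simp_rw [hval] at hS
  have hw : ‖-(z ^ (-(ρ : ℂ)))‖ < 1 := by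
    rw [norm_neg, show (-(ρ : ℂ)) = ((-ρ : ℝ) : ℂ) by push_cast; rfl, Complex.norm_cpow_real]
    exact Real.rpow_lt_one_of_one_lt_of_neg hzn (by linarith)
  have hS' := (hasSum_geometric_of_norm_lt_one hw).mul_left z⁻¹
  rw [sub_neg_eq_add] at hS'
  rw [resolventLaplace, ← hS.unique hS']
  refine setIntegral_congr_fun measurableSet_Ioi fun t ht => ?_
  have h1 := (hasSum_mittagLeffler hρ (-(1 * t ^ ρ)))
  simp_rw [scalarResolvent_term (le_of_lt ht)] at h1
  have h2 := ((Complex.hasSum_ofReal.2 h1).mul_right (Complex.exp (-z * t))).tsum_eq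
  simp only [scalarResolvent]
  rw [← h2]
  refine tsum_congr fun k => ?_
  simp only [hF]
  push_cast
  ring

/-- Square integrals of the Laplace transform on vertical lines are uniformly bounded. -/
lemma exists_bound_integral_resolventLaplace {ρ : ℝ} (hρ : 1 / 2 < ρ) (hρ' : ρ < 2) :
    ∃ B : ℝ, ∀ σ : ℝ, 0 < σ →
      Integrable (fun x : ℝ =>
        ‖resolventLaplace ρ (σ + (2 * Real.pi * x : ℝ) * Complex.I)‖ ^ 2) ∧
      ∫ x : ℝ, ‖resolventLaplace ρ (σ + (2 * Real.pi * x : ℝ) * Complex.I)‖ ^ 2 ≤ B := by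
  have hρ0 : 0 < ρ := by linarith
  obtain ⟨C, hC, h⟩ := exists_resolventLaplace_bound hρ0 hρ'
  have hI := ((integrable_min_rpow_abs (β := min ρ 1) (lt_min hρ (by norm_num))).comp_mul_left'
    (R := 2 * Real.pi) (by positivity)).const_mul C
  refine ⟨∫ x : ℝ, C * min (|2 * Real.pi * x| ^ (-2 : ℝ)) (|2 * Real.pi * x| ^ (2 * min ρ 1 - 2)),
    fun σ hσ => ?_⟩
  have hre : ∀ x : ℝ, 0 < ((σ : ℂ) + (2 * Real.pi * x : ℝ) * Complex.I).re := by
    intro x; simpa using hσ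
  have hle : ∀ᵐ x : ℝ, ‖resolventLaplace ρ (σ + (2 * Real.pi * x : ℝ) * Complex.I)‖ ^ 2 ≤
      C * min (|2 * Real.pi * x| ^ (-2 : ℝ)) (|2 * Real.pi * x| ^ (2 * min ρ 1 - 2)) := by
    -- At `x = 0` the convention `0 ^ (-2) = 0` would make the bound false.
    have h0 : ∀ᵐ x : ℝ, x ≠ 0 := by simp [ae_iff]
    filter_upwards [h0] with x hx
    have him : ((σ : ℂ) + (2 * Real.pi * x : ℝ) * Complex.I).im = 2 * Real.pi * x := by simp
    have := norm_sq_resolventLaplace_le (h _ (hre x)).2.1 (h _ (hre x)).2.2 hC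
      (by rw [him]; have := Real.pi_pos; positivity)
    rwa [him] at this
  have hcont : Continuous fun x : ℝ =>
      ‖resolventLaplace ρ (σ + (2 * Real.pi * x : ℝ) * Complex.I)‖ ^ 2 :=
    ((differentiableOn_resolventLaplace hρ0 hρ').continuousOn.comp_continuous (by fun_prop)
      hre).norm.pow 2
  have hint := hI.mono' hcont.aestronglyMeasurable (by
    filter_upwards [hle] with x hx
    rwa [Real.norm_of_nonneg (by positivity)])
  exact ⟨hint, integral_mono_ae hint hI hle⟩

open scoped FourierTransform in
/-- The energy identity, from Plancherel's theorem, in the half-plane of absolute convergence. -/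
lemma integral_scalarResolvent_sq_mul_exp {ρ : ℝ} (hρ : 1 / 2 < ρ) (hρ' : ρ < 2) {σ : ℝ}
    (hσ : 2 ^ ρ⁻¹ < σ) :
    ∫ t in Ioi (0 : ℝ), scalarResolvent ρ 1 t ^ 2 * Real.exp (-2 * σ * t) =
      ∫ x : ℝ, ‖resolventLaplace ρ (σ + (2 * Real.pi * x : ℝ) * Complex.I)‖ ^ 2 := by
  have hρ0 : 0 < ρ := by linarith
  have hσ1 : 1 < σ := (Real.one_lt_rpow one_lt_two (inv_pos.2 hρ0)).trans hσ
  obtain ⟨B, hB⟩ := exists_bound_integral_resolventLaplace hρ hρ'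
  set f : ℝ → ℂ := (Ioi (0 : ℝ)).indicator
    fun t => ((scalarResolvent ρ 1 t * Real.exp (-σ * t) : ℝ) : ℂ) with hf
  have hf1 : Integrable f :=
    (integrable_indicator_iff measurableSet_Ioi).2
      (integrableOn_scalarResolvent_mul_exp hρ0 hσ).ofReal
  have hsq : (fun t => ‖f t‖ ^ 2) = (Ioi (0 : ℝ)).indicator
      fun t => scalarResolvent ρ 1 t ^ 2 * Real.exp (-2 * σ * t) := by
    funext t
    by_cases ht : t ∈ Ioi (0 : ℝ)
    · rw [hf, indicator_of_mem ht, indicator_of_mem ht, Complex.norm_real, Real.norm_eq_abs,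
        sq_abs, mul_pow, ← Real.exp_nat_mul]
      push_cast
      ring_nf
    · simp [hf, indicator_of_notMem ht]
  have hf2 : MemLp f 2 := by
    rw [memLp_two_iff_integrable_sq_norm hf1.1, hsq]
    exact (integrableOn_scalarResolvent_sq_mul_exp hρ0 hσ).integrable_indicator measurableSet_Ioi
  -- The kernel of `𝓕` is e^(-2πixt), whence the factor 2π on the vertical line.
  have hFf : 𝓕 f = fun x : ℝ =>
      resolventLaplace ρ (σ + (2 * Real.pi * x : ℝ) * Complex.I) := by
    funext x
    rw [Real.fourier_real_eq_integral_exp_smul, ← laplace_scalarResolvent hρ0 (by simpa using hσ1),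
      ← integral_indicator measurableSet_Ioi]
    congr 1
    funext t
    by_cases ht : t ∈ Ioi (0 : ℝ)
    · rw [hf, indicator_of_mem ht, indicator_of_mem ht, smul_eq_mul]
      push_cast
      rw [mul_left_comm, ← Complex.exp_add]
      congr 2
      ring
    · simp [hf, indicator_of_notMem ht]
  have hF2 : MemLp (𝓕 f) 2 := by
    have hc : Continuous (𝓕 f) := by
      rw [hFf]
      exact (differentiableOn_resolventLaplace hρ0 hρ').continuousOn.comp_continuous (by fun_prop)
        fun x => by simpa using one_pos.trans hσ1
    rw [memLp_two_iff_integrable_sq_norm hc.aestronglyMeasurable, hFf]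
    exact (hB σ (by linarith)).1
  have hP := eLpNorm_fourier_eq hf1 hf2 hF2
  rw [hF2.eLpNorm_eq_integral_rpow_norm two_ne_zero ENNReal.ofNat_ne_top,
    hf2.eLpNorm_eq_integral_rpow_norm two_ne_zero ENNReal.ofNat_ne_top,
    ENNReal.ofReal_eq_ofReal_iff (by positivity) (by positivity),
    Real.rpow_left_inj (by positivity) (by positivity) (by simp)] at hP
  simp only [ENNReal.toReal_ofNat, Real.rpow_ofNat] at hP
  rw [hsq, integral_indicator measurableSet_Ioi, hFf] at hP
  exact hP.symm

/-- The scalar resolvent with `a = 1` is square integrable on the half-line. -/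
lemma integrableOn_scalarResolvent_one_sq {ρ : ℝ} (hρ : 1 / 2 < ρ) (hρ' : ρ < 2) :
    IntegrableOn (fun t => scalarResolvent ρ 1 t ^ 2) (Ioi 0) := by
  have hρ0 : 0 < ρ := by linarith
  obtain ⟨B, hB⟩ := exists_bound_integral_resolventLaplace hρ hρ'
  obtain ⟨C, hC, hbound⟩ := exists_resolventLaplace_bound hρ0 hρ'
  set lam : ℝ := 2 ^ ρ⁻¹ with hlam
  have hlam0 : 0 < lam := by positivity
  have hsc : Continuous fun t => scalarResolvent ρ 1 t ^ 2 :=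
    (continuous_scalarResolvent hρ0 1).pow 2
  have hmeas : Measurable fun t => ENNReal.ofReal (scalarResolvent ρ 1 t ^ 2) :=
    hsc.measurable.ennreal_ofReal
  set ν : Measure ℝ := (volume.restrict (Ioi (0 : ℝ))).withDensity
    fun t => ENNReal.ofReal (scalarResolvent ρ 1 t ^ 2) with hν
  have hνpos : ∀ᵐ t ∂ν, 0 ≤ t := by
    refine (withDensity_absolutelyContinuous _ _).ae_le ?_
    filter_upwards [ae_restrict_mem measurableSet_Ioi] with t ht using le_of_lt ht
  have hmgf : ∀ x : ℝ, mgf id ν x =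
      ∫ t in Ioi (0 : ℝ), scalarResolvent ρ 1 t ^ 2 * Real.exp (x * t) := by
    intro x
    rw [mgf, hν, integral_withDensity_eq_integral_toReal_smul hmeas (by simp)]
    refine integral_congr_ae (ae_of_all _ fun t => ?_)
    simp only [id, ENNReal.toReal_ofReal (sq_nonneg _), smul_eq_mul]
  have hset : Iio (-2 * lam) ⊆ integrableExpSet id ν := by
    intro x hx
    change Integrable _ _
    rw [hν, integrable_withDensity_iff_integrable_smul' hmeas (by simp)]
    have := integrableOn_scalarResolvent_sq_mul_exp hρ0 (σ := -x / 2)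
      (by have : x < -2 * lam := hx
          linarith)
    refine this.congr (ae_of_all _ fun t => ?_)
    simp only [id, ENNReal.toReal_ofReal (sq_nonneg _), smul_eq_mul]
    ring_nf
  -- Any point left of `-2 * lam` would do: the disk around `u` of radius `-u` lies in Re w < 0 and
  -- touches 0.
  set u : ℝ := -2 * lam - 1 with hu
  have hu0 : u < 0 := by linarith
  have huint : u ∈ interior (integrableExpSet id ν) :=
    interior_maximal hset isOpen_Iio (show u < -2 * lam by linarith)
  set G : ℂ → ℂ := fun s => ∫ x : ℝ, resolventLaplace ρ (s + x * Complex.I) *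
    resolventLaplace ρ (s - x * Complex.I) with hG
  -- The exponent is `w = -2σ`, so σ is `-w / 2`; the prefactor comes from replacing `2πx` by `x`.
  set H : ℂ → ℂ := fun w => (2 * Real.pi : ℝ)⁻¹ * G (-w / 2) with hH
  have hnb : ∀ z : ℂ, 0 < z.re → ‖resolventLaplace ρ z‖ ≤ √C * ‖z‖⁻¹ := by
    intro z hz
    refine Real.le_sqrt_of_sq_le ?_ |>.trans_eq ?_ (b := √(C * (‖z‖⁻¹) ^ 2))
    · refine (hbound z hz).2.1.trans_eq ?_
      rw [Real.rpow_neg (norm_nonneg _), Real.rpow_ofNat, inv_pow]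
    · rw [Real.sqrt_mul hC.le, Real.sqrt_sq (by positivity)]
  have hHd : DifferentiableOn ℂ H (Metric.ball (u : ℂ) (-u)) := by
    intro w hw
    have hwre : w.re < 0 := by
      rw [mem_ball_iff_norm] at hw
      have := (Complex.abs_re_le_norm (w - u)).trans_lt hw
      rw [Complex.sub_re, Complex.ofReal_re] at this
      have := (abs_lt.1 this).2
      linarith
    have hGd : DifferentiableAt ℂ G (-w / 2) :=
      differentiableAt_integral_vertical (differentiableOn_resolventLaplace hρ0 hρ') hnb
        (by simp; linarith)
    exact ((hGd.comp w (by fun_prop : DifferentiableAt ℂ (fun w : ℂ => -w / 2) w)).const_mul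
      _).differentiableWithinAt
  have hHval : ∀ x : ℝ, x < 0 → H x =
      ((∫ y : ℝ, ‖resolventLaplace ρ ((-x / 2 : ℝ) + (2 * Real.pi * y : ℝ) * Complex.I)‖ ^ 2 : ℝ) :
        ℂ) := by
    intro x hx
    have hsub := Measure.integral_comp_mul_left (fun y : ℝ =>
      ‖resolventLaplace ρ ((-x / 2 : ℝ) + (y : ℝ) * Complex.I)‖ ^ 2) (2 * Real.pi)
    rw [hsub, abs_of_pos (by positivity), smul_eq_mul]
    simp only [hH, hG]
    rw [Complex.ofReal_mul, ← integral_complex_ofReal]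
    congr 1
    refine integral_congr_ae (ae_of_all _ fun y => ?_)
    have hz : 0 < (((-x / 2 : ℝ) : ℂ) + y * Complex.I).re := by simp; linarith
    have hconj : (-(x : ℂ) / 2 - y * Complex.I) =
        (starRingEnd ℂ) (((-x / 2 : ℝ) : ℂ) + y * Complex.I) := by
      rw [map_add, map_mul, Complex.conj_ofReal, Complex.conj_ofReal, Complex.conj_I]
      push_cast
      ring
    simp only
    rw [hconj, resolventLaplace_conj ρ hz, Complex.ofReal_pow, ← Complex.mul_conj']
    push_cast
    rfl
  have heq : ∀ᶠ x : ℝ in 𝓝 u, H x = mgf id ν x := by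
    filter_upwards [Iio_mem_nhds (show u < -2 * lam by linarith)] with x hx
    have hx' : x < -2 * lam := hx
    rw [hHval x (by linarith), hmgf, Complex.ofReal_inj,
      ← integral_scalarResolvent_sq_mul_exp hρ hρ' (σ := -x / 2) (by linarith)]
    ring_nf
  -- The exponents `u / (n + 1)` increase to 0 inside the disk; the bound `B` does not depend on
  -- them, so Fatou applies.
  have hfin : ∀ n : ℕ, ∫⁻ t, ENNReal.ofReal (Real.exp (u * ((n : ℝ) + 1)⁻¹ * t)) ∂ν ≤
      ENNReal.ofReal B := by
    intro n
    have hn : 0 < ((n : ℝ) + 1)⁻¹ := by positivity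
    have hn1 : ((n : ℝ) + 1)⁻¹ ≤ 1 := inv_le_one_of_one_le₀ (by linarith [n.cast_nonneg (α := ℝ)])
    have := lintegral_exp_eq_of_differentiableOn_ball hνpos huint hHd heq
      (v := -u + u * ((n : ℝ) + 1)⁻¹) (by nlinarith) (by nlinarith)
    rw [show u + (-u + u * ((n : ℝ) + 1)⁻¹) = u * ((n : ℝ) + 1)⁻¹ by ring] at this
    rw [this, hHval _ (by nlinarith), Complex.ofReal_re]
    exact ENNReal.ofReal_le_ofReal (hB _ (by nlinarith)).2
  have huniv : ν univ ≤ ENNReal.ofReal B := by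
    have hlim : ∀ t : ℝ, Tendsto
        (fun n : ℕ => ENNReal.ofReal (Real.exp (u * ((n : ℝ) + 1)⁻¹ * t))) atTop (𝓝 1) := by
      intro t
      have h1 : Tendsto (fun n : ℕ => ((n : ℝ) + 1)⁻¹) atTop (𝓝 0) := by
        simpa using tendsto_one_div_add_atTop_nhds_zero_nat (𝕜 := ℝ)
      have h2 : Tendsto (fun n : ℕ => Real.exp (u * ((n : ℝ) + 1)⁻¹ * t)) atTop (𝓝 1) := by
        have := (Real.continuous_exp.tendsto _).comp ((h1.const_mul u).mul_const t)
        simpa [Function.comp_def] using this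
      simpa using ENNReal.tendsto_ofReal h2
    calc ν univ = ∫⁻ t, liminf
          (fun n : ℕ => ENNReal.ofReal (Real.exp (u * ((n : ℝ) + 1)⁻¹ * t))) atTop ∂ν := by
          simp_rw [(hlim _).liminf_eq]
          simp
      _ ≤ liminf (fun n : ℕ => ∫⁻ t, ENNReal.ofReal (Real.exp (u * ((n : ℝ) + 1)⁻¹ * t)) ∂ν)
          atTop := lintegral_liminf_le fun n => by fun_prop
      _ ≤ ENNReal.ofReal B := by
          refine (liminf_le_liminf (v := fun _ => ENNReal.ofReal B)
            (Eventually.of_forall hfin)).trans_eq (by simp)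
  refine ⟨hsc.aestronglyMeasurable, ?_⟩
  rw [hasFiniteIntegral_iff_ofReal (ae_of_all _ fun t => sq_nonneg _)]
  rw [hν, withDensity_apply _ MeasurableSet.univ, Measure.restrict_univ] at huniv
  exact huniv.trans_lt ENNReal.ofReal_lt_top

/-- Square integrability of the scalar resolvent and the scaling of its norm. -/
theorem exists_scalarResolvent_memLp_bound {ρ : ℝ} (hρ : 1 / 2 < ρ) (hρ' : ρ < 2) :
    ∃ c : ℝ, 0 < c ∧ ∀ a : ℝ, 0 < a →
      MemLp (scalarResolvent ρ a) 2 (volume.restrict (Ioi 0)) ∧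
      ∫ t in Ioi (0 : ℝ), scalarResolvent ρ a t ^ 2 ≤ c * a ^ (-(1 / ρ)) := by
  have hρ0 : 0 < ρ := by linarith
  have h1 := integrableOn_scalarResolvent_one_sq hρ hρ'
  have hI0 : 0 ≤ ∫ t in Ioi (0 : ℝ), scalarResolvent ρ 1 t ^ 2 :=
    integral_nonneg fun t => sq_nonneg _
  -- Adding 1 merely makes the constant visibly positive.
  refine ⟨(∫ t in Ioi (0 : ℝ), scalarResolvent ρ 1 t ^ 2) + 1, by linarith, fun a ha => ?_⟩
  have hb : 0 < a ^ ρ⁻¹ := by positivity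
  have hscale : EqOn (fun t => scalarResolvent ρ a t ^ 2)
      (fun t => scalarResolvent ρ 1 (a ^ ρ⁻¹ * t) ^ 2) (Ioi 0) := fun t ht => by
    simp only [scalarResolvent_eq_scale hρ0 ha (le_of_lt ht)]
  constructor
  · rw [memLp_two_iff_integrable_sq (continuous_scalarResolvent hρ0 a).aestronglyMeasurable]
    have := (integrableOn_Ioi_comp_mul_left_iff (fun t => scalarResolvent ρ 1 t ^ 2) 0 hb).2
      (by simpa using h1)
    exact (integrableOn_congr_fun hscale measurableSet_Ioi).2 this
  · rw [setIntegral_congr_fun measurableSet_Ioi hscale,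
      integral_comp_mul_left_Ioi (fun t => scalarResolvent ρ 1 t ^ 2) 0 hb, mul_zero, smul_eq_mul,
      ← Real.rpow_neg ha.le, one_div, mul_comm]
    gcongr
    linarith

/-! ### The two-sided Wiener process: Gaussianity and covariance -/

/-- The step function `1_(0, t]` for `t ≥ 0` and `-1_(t, 0]` for `t ≤ 0`, whose Wiener integral is
`W t`. -/
noncomputable def wienerStep (t u : ℝ) : ℝ :=
  (Ioc 0 t).indicator 1 u - (Ioc t 0).indicator 1 u

lemma memLp_wienerStep (t : ℝ) : MemLp (wienerStep t) 2 volume :=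
  (memLp_indicator_const 2 measurableSet_Ioc (1 : ℝ) (Or.inr (by simp))).sub
    (memLp_indicator_const 2 measurableSet_Ioc (1 : ℝ) (Or.inr (by simp)))

lemma wienerStep_of_nonneg {t : ℝ} (ht : 0 ≤ t) : wienerStep t = (Ioc 0 t).indicator 1 := by
  funext u
  simp [wienerStep, Ioc_eq_empty_of_le ht]

lemma wienerStep_of_nonpos {t : ℝ} (ht : t ≤ 0) : wienerStep t = -(Ioc t 0).indicator 1 := by
  funext u
  simp [wienerStep, Ioc_eq_empty_of_le ht]

lemma wienerStep_sub {l r : ℝ} (h : l ≤ r) (u : ℝ) :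
    wienerStep r u - wienerStep l u = (Ioc l r).indicator 1 u := by
  simp only [wienerStep, indicator_apply, mem_Ioc, Pi.one_apply]
  split_ifs <;> grind

lemma integral_wienerStep_mul_of_nonneg {s t : ℝ} (hs : 0 ≤ s) (ht : 0 ≤ t) :
    ∫ u, wienerStep s u * wienerStep t u = min s t := by
  have : ∀ u, wienerStep s u * wienerStep t u = (Ioc 0 (min s t)).indicator 1 u := by
    intro u
    rw [wienerStep_of_nonneg hs, wienerStep_of_nonneg ht, ← inter_indicator_mul, Ioc_inter_Ioc]
    simp
    rfl
  simp_rw [this]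
  rw [integral_indicator_one measurableSet_Ioc, Real.volume_real_Ioc_of_le (le_min hs ht), sub_zero]

lemma integral_wienerStep_mul_of_nonpos {s t : ℝ} (hs : s ≤ 0) (ht : t ≤ 0) :
    ∫ u, wienerStep s u * wienerStep t u = min (-s) (-t) := by
  have : ∀ u, wienerStep s u * wienerStep t u = (Ioc (max s t) 0).indicator 1 u := by
    intro u
    rw [wienerStep_of_nonpos hs, wienerStep_of_nonpos ht, Pi.neg_apply, Pi.neg_apply, neg_mul_neg,
      ← inter_indicator_mul, Ioc_inter_Ioc]
    simp
    rfl
  simp_rw [this]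
  rw [integral_indicator_one measurableSet_Ioc, Real.volume_real_Ioc_of_le (max_le hs ht), zero_sub,
    min_neg_neg]

lemma integral_wienerStep_mul_of_nonneg_of_nonpos {s t : ℝ} (hs : 0 ≤ s) (ht : t ≤ 0) :
    ∫ u, wienerStep s u * wienerStep t u = 0 := by
  have : ∀ u, wienerStep s u * wienerStep t u = 0 := by
    intro u
    rw [wienerStep_of_nonneg hs, wienerStep_of_nonpos ht, Pi.neg_apply]
    simp only [indicator_apply, mem_Ioc]
    split_ifs <;> simp
    linarith
  simp [this]

section Wiener

variable {Ω : Type*} [MeasurableSpace Ω] {P : Measure Ω} {W : ℝ → Ω → ℝ}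

/-- Independent Gaussian vectors are jointly Gaussian, and finitely many values of `W` are a linear
image of forward and backward values. -/
lemma IsTwoSidedWiener.isGaussianProcess (hW : IsTwoSidedWiener W P) : IsGaussianProcess W P where
  hasGaussianLaw I := by
    classical
    set J : Finset ℝ≥0 := I.image Real.toNNReal ∪ I.image (fun t => (-t).toNNReal) with hJ
    have hX := hW.forward.isGaussianProcess.hasGaussianLaw J
    have hY := hW.backward.isGaussianProcess.hasGaussianLaw J
    have hXY := hW.indep.comp (Finset.measurable_restrict J) (Finset.measurable_restrict J)
    have hG := hXY.hasGaussianLaw hX hY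
    have h1 : ∀ i : I, (i : ℝ).toNNReal ∈ J := fun i => by
      rw [hJ, Finset.mem_union]
      exact Or.inl (Finset.mem_image_of_mem _ i.2)
    have h2 : ∀ i : I, (-(i : ℝ)).toNNReal ∈ J := fun i => by
      rw [hJ, Finset.mem_union]
      exact Or.inr (Finset.mem_image_of_mem (fun t : ℝ => (-t).toNNReal) i.2)
    let L : ((J → ℝ) × (J → ℝ)) →L[ℝ] (I → ℝ) := ContinuousLinearMap.pi fun i =>
      if 0 ≤ (i : ℝ) then
        (ContinuousLinearMap.proj (R := ℝ) (φ := fun _ : J => ℝ) ⟨_, h1 i⟩).comp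
          (ContinuousLinearMap.fst ℝ (J → ℝ) (J → ℝ))
      else (ContinuousLinearMap.proj (R := ℝ) (φ := fun _ : J => ℝ) ⟨_, h2 i⟩).comp
          (ContinuousLinearMap.snd ℝ (J → ℝ) (J → ℝ))
    convert! hG.map L using 1
    funext ω i
    by_cases hi : 0 ≤ (i : ℝ)
    · simp [L, hi]
    · have hi' : 0 ≤ -(i : ℝ) := by linarith
      simp [L, hi, Real.coe_toNNReal _ hi']

lemma IsTwoSidedWiener.memLp (hW : IsTwoSidedWiener W P) (t : ℝ) : MemLp (W t) 2 P :=
  (hW.isGaussianProcess.hasGaussianLaw_eval t).memLp_two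

lemma IsTwoSidedWiener.integral_eq_zero (hW : IsTwoSidedWiener W P) (t : ℝ) :
    ∫ ω, W t ω ∂P = 0 := by
  rcases le_total 0 t with ht | ht
  · exact hW.forward.integral_eval ⟨t, ht⟩
  · have := hW.backward.integral_eval (-t).toNNReal
    simpa [Real.coe_toNNReal (-t) (by linarith)] using this

/-- The covariance is a minimum on each side of 0 and vanishes across 0 by independence; the
overlaps of the intervals show the same pattern. This is the isometry on generators. -/
lemma IsTwoSidedWiener.integral_mul (hW : IsTwoSidedWiener W P) (s t : ℝ) :
    ∫ ω, W s ω * W t ω ∂P = ∫ u, wienerStep s u * wienerStep t u := by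
  have hP : IsProbabilityMeasure P := hW.isGaussianProcess.isProbabilityMeasure
  have hcov : ∀ s t : ℝ, ∫ ω, W s ω * W t ω ∂P = cov[W s, W t; P] := by
    intro s t
    rw [covariance_eq_sub (hW.memLp s) (hW.memLp t), hW.integral_eq_zero]
    simp
  have hmixed : ∀ s t : ℝ, 0 ≤ s → t ≤ 0 → cov[W s, W t; P] = 0 := by
    intro s t hs ht
    have hi := hW.indep.comp (measurable_pi_apply s.toNNReal) (measurable_pi_apply (-t).toNNReal)
    have : IndepFun (W s) (W t) P := by
      simpa [Function.comp_def, Real.coe_toNNReal s hs, Real.coe_toNNReal (-t) (by linarith)]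
        using hi
    exact this.covariance_eq_zero (hW.memLp s) (hW.memLp t)
  rw [hcov]
  rcases le_total 0 s with hs | hs <;> rcases le_total 0 t with ht | ht
  · rw [integral_wienerStep_mul_of_nonneg hs ht]
    exact_mod_cast hW.forward.covariance_eval ⟨s, hs⟩ ⟨t, ht⟩
  · rw [integral_wienerStep_mul_of_nonneg_of_nonpos hs ht, hmixed s t hs ht]
  · simp_rw [mul_comm (wienerStep s _)]
    rw [integral_wienerStep_mul_of_nonneg_of_nonpos ht hs, covariance_comm, hmixed t s ht hs]
  · rw [integral_wienerStep_mul_of_nonpos hs ht]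
    have := hW.backward.covariance_eval (-s).toNNReal (-t).toNNReal
    simpa [Real.coe_toNNReal (-s) (by linarith), Real.coe_toNNReal (-t) (by linarith)] using this

end Wiener

/-! ### The graph of the elementary integral: isometry and Gaussian laws -/

lemma inner_toLp_eq_integral_mul {α : Type*} [MeasurableSpace α] {μ : Measure α} {f g : α → ℝ}
    (hf : MemLp f 2 μ) (hg : MemLp g 2 μ) :
    inner ℝ (hf.toLp f) (hg.toLp g) = ∫ x, f x * g x ∂μ := by
  rw [L2.inner_def]
  refine integral_congr_ae ?_
  filter_upwards [hf.coeFn_toLp, hg.coeFn_toLp] with x h1 h2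
  rw [h1, h2, RCLike.inner_apply]
  simp [mul_comm]

lemma Lp.coeFn_sum_smul {α ι : Type*} [MeasurableSpace α] {μ : Measure α} (s : Finset ι)
    (c : ι → ℝ) (f : ι → Lp ℝ 2 μ) :
    (∑ i ∈ s, c i • f i : Lp ℝ 2 μ) =ᵐ[μ] fun x => ∑ i ∈ s, c i * f i x := by
  classical
  induction s using Finset.induction_on with
  | empty =>
    simp only [Finset.sum_empty]
    exact Lp.coeFn_zero ℝ 2 μ
  | insert i s hi ih =>
    simp only [Finset.sum_insert hi]
    filter_upwards [Lp.coeFn_add (c i • f i) (∑ i ∈ s, c i • f i), Lp.coeFn_smul (c i) (f i), ih]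
      with x h1 h2 h3
    rw [h1, Pi.add_apply, h2, h3, Pi.smul_apply, smul_eq_mul]

lemma toLp_sum_mul {α ι : Type*} [MeasurableSpace α] {μ : Measure α} (s : Finset ι)
    (c : ι → ℝ) {f : ι → α → ℝ} (hf : ∀ i, MemLp (f i) 2 μ)
    (hs : MemLp (fun x => ∑ i ∈ s, c i * f i x) 2 μ) :
    hs.toLp _ = ∑ i ∈ s, c i • (hf i).toLp (f i) := by
  refine Lp.ext (hs.coeFn_toLp.trans ((Lp.coeFn_sum_smul s c _).trans ?_).symm)
  have : ∀ᵐ x ∂μ, ∀ i ∈ s, (hf i).toLp (f i) x = f i x :=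
    (ae_ball_iff s.countable_toSet).2 fun i _ => (hf i).coeFn_toLp
  filter_upwards [this] with x hx
  exact Finset.sum_congr rfl fun i hi => by rw [hx i hi]

section Wiener

variable {Ω : Type*} [MeasurableSpace Ω] {P : Measure Ω} {W : ℝ → Ω → ℝ}

/-- The pairs formed by a linear combination of the basic step functions and its integral. -/
noncomputable def wienerGraph (hW : IsTwoSidedWiener W P) :
    Submodule ℝ (Lp ℝ 2 (volume : Measure ℝ) × Lp ℝ 2 P) :=
  Submodule.span ℝ (range fun t =>
    ((memLp_wienerStep t).toLp (wienerStep t), (hW.memLp t).toLp (W t)))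

lemma mem_wienerGraph (hW : IsTwoSidedWiener W P) (t : ℝ) :
    ((memLp_wienerStep t).toLp (wienerStep t), (hW.memLp t).toLp (W t)) ∈ wienerGraph hW :=
  Submodule.subset_span (mem_range_self t)

/-- The Itô isometry for step functions. -/
lemma inner_eq_of_mem_wienerGraph (hW : IsTwoSidedWiener W P)
    {p q : Lp ℝ 2 (volume : Measure ℝ) × Lp ℝ 2 P} (hp : p ∈ wienerGraph hW)
    (hq : q ∈ wienerGraph hW) : inner ℝ p.1 q.1 = inner ℝ p.2 q.2 := by
  induction hp using Submodule.span_induction with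
  | mem p hp =>
    obtain ⟨s, rfl⟩ := hp
    induction hq using Submodule.span_induction with
    | mem q hq =>
      obtain ⟨t, rfl⟩ := hq
      simp only
      rw [inner_toLp_eq_integral_mul, inner_toLp_eq_integral_mul, hW.integral_mul]
    | zero => simp
    | add x y _ _ hx hy => simp only [Prod.fst_add, Prod.snd_add, inner_add_right, hx, hy]
    | smul a x _ hx => simp only [Prod.smul_fst, Prod.smul_snd, inner_smul_right, hx]
  | zero => simp
  | add x y _ _ hx hy => simp only [Prod.fst_add, Prod.snd_add, inner_add_left, hx, hy]
  | smul a x _ hx => simp only [Prod.smul_fst, Prod.smul_snd, inner_smul_left, hx]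

lemma norm_eq_of_mem_wienerGraph (hW : IsTwoSidedWiener W P)
    {p : Lp ℝ 2 (volume : Measure ℝ) × Lp ℝ 2 P} (hp : p ∈ wienerGraph hW) : ‖p.1‖ = ‖p.2‖ := by
  have h := inner_eq_of_mem_wienerGraph hW hp hp
  rw [real_inner_self_eq_norm_sq, real_inner_self_eq_norm_sq] at h
  exact (sq_eq_sq₀ (norm_nonneg _) (norm_nonneg _)).1 h

lemma exists_finsupp_ae_eq_of_mem_wienerGraph (hW : IsTwoSidedWiener W P)
    {p : Lp ℝ 2 (volume : Measure ℝ) × Lp ℝ 2 P} (hp : p ∈ wienerGraph hW) :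
    ∃ c : ℝ →₀ ℝ, p.2 =ᵐ[P] fun ω => ∑ t ∈ c.support, c t * W t ω := by
  obtain ⟨c, rfl⟩ := Finsupp.mem_span_range_iff_exists_finsupp.1 hp
  refine ⟨c, ?_⟩
  change _ =ᵐ[P] fun ω => c.sum fun t a => a * W t ω
  clear hp
  induction c using Finsupp.induction_linear with
  | zero =>
    simp only [Finsupp.sum_zero_index]
    exact Lp.coeFn_zero ℝ 2 P
  | add f g hf hg =>
    rw [Finsupp.sum_add_index' (by simp) (by intros; rw [add_smul]), Prod.snd_add]
    filter_upwards [Lp.coeFn_add (f.sum fun i a => a • ((memLp_wienerStep i).toLp (wienerStep i),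
      (hW.memLp i).toLp (W i))).2 (g.sum fun i a => a • ((memLp_wienerStep i).toLp (wienerStep i),
      (hW.memLp i).toLp (W i))).2, hf, hg] with ω h1 h2 h3
    rw [h1, Pi.add_apply, h2, h3, Finsupp.sum_add_index' (by simp) (by intros; ring)]
  | single t a =>
    rw [Finsupp.sum_single_index (by simp), Prod.smul_snd]
    filter_upwards [Lp.coeFn_smul a ((hW.memLp t).toLp (W t)), (hW.memLp t).coeFn_toLp] with ω h1 h2
    rw [h1, Pi.smul_apply, h2, Finsupp.sum_single_index (by simp), smul_eq_mul]

/-- A finite combination of values of `W` is centred Gaussian, and the isometry identifies its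
variance with the squared norm of the integrand. -/
lemma map_eq_gaussianReal_of_mem_wienerGraph (hW : IsTwoSidedWiener W P)
    {p : Lp ℝ 2 (volume : Measure ℝ) × Lp ℝ 2 P} (hp : p ∈ wienerGraph hW) :
    P.map p.2 = gaussianReal 0 (‖p.1‖ ^ 2).toNNReal := by
  obtain ⟨c, hc⟩ := exists_finsupp_ae_eq_of_mem_wienerGraph hW hp
  have hP : IsProbabilityMeasure P := hW.isGaussianProcess.isProbabilityMeasure
  have hG : HasGaussianLaw p.2 P :=
    ((hW.isGaussianProcess.smul c).hasGaussianLaw_fun_sum (I := c.support)).congr hc.symm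
  have h0 : ∫ ω, p.2 ω ∂P = 0 := by
    rw [integral_congr_ae hc, integral_finsetSum _ fun t _ =>
      ((hW.memLp t).integrable one_le_two).const_mul _]
    simp_rw [integral_const_mul, hW.integral_eq_zero]
    simp
  have hvar : Var[p.2; P] = ‖p.1‖ ^ 2 := by
    rw [variance_of_integral_eq_zero hG.aemeasurable h0, norm_eq_of_mem_wienerGraph hW hp,
      ← real_inner_self_eq_norm_sq, L2.inner_def]
    refine integral_congr_ae (ae_of_all _ fun ω => ?_)
    simp [sq]
  rw [hG.map_eq_gaussianReal, h0, hvar]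

/-- The law of a Wiener integral: the first component of a pair in the closure of the graph is
the integrand, the second one the integral. -/
lemma map_eq_gaussianReal_of_mem_closure (hW : IsTwoSidedWiener W P)
    {p : Lp ℝ 2 (volume : Measure ℝ) × Lp ℝ 2 P} (hp : p ∈ (wienerGraph hW).topologicalClosure) :
    P.map p.2 = gaussianReal 0 (‖p.1‖ ^ 2).toNNReal := by
  have hP : IsProbabilityMeasure P := hW.isGaussianProcess.isProbabilityMeasure
  obtain ⟨q, hq, hlim⟩ := mem_closure_iff_seq_limit.1 hp
  have h1 : Tendsto (fun n => (q n).1) atTop (𝓝 p.1) := (continuous_fst.tendsto p).comp hlim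
  have h2 : Tendsto (fun n => (q n).2) atTop (𝓝 p.2) := (continuous_snd.tendsto p).comp hlim
  have hD : TendstoInDistribution (fun n => ((q n).2 : Ω → ℝ)) atTop p.2 (fun _ => P) P :=
    (tendstoInMeasure_of_tendsto_Lp h2).tendstoInDistribution
      fun n => (Lp.aestronglyMeasurable _).aemeasurable
  have hpm : AEMeasurable p.2 P := (Lp.aestronglyMeasurable _).aemeasurable
  have : IsProbabilityMeasure (P.map p.2) := Measure.isProbabilityMeasure_map hpm
  -- L² convergence implies convergence in law, and the Gaussian characteristic functions converge
  -- because the norms of the integrands do.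
  refine Measure.ext_of_charFun (funext fun u => ?_)
  have hc := ProbabilityMeasure.tendsto_iff_tendsto_charFun.1 hD.tendsto u
  refine tendsto_nhds_unique hc ?_
  simp only [ProbabilityMeasure.coe_mk, map_eq_gaussianReal_of_mem_wienerGraph hW (hq _),
    charFun_gaussianReal]
  have hcont : Tendsto (fun n => ((‖(q n).1‖ ^ 2).toNNReal : ℝ)) atTop
      (𝓝 ((‖p.1‖ ^ 2).toNNReal : ℝ)) := by
    simp only [Real.coe_toNNReal _ (sq_nonneg _)]
    exact h1.norm.pow 2
  have hcont' := (Complex.continuous_ofReal.tendsto _).comp hcont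
  exact (Complex.continuous_exp.tendsto _).comp
    (tendsto_const_nhds.sub ((hcont'.mul_const _).div_const _))

lemma StepFn.toFun_eq (φ : StepFn) (u : ℝ) :
    φ.toFun u = ∑ i, φ.coeff i * (wienerStep (φ.right i) u - wienerStep (φ.left i) u) := by
  refine Finset.sum_congr rfl fun i _ => ?_
  rw [wienerStep_sub (φ.left_le_right i)]
  simp [indicator_apply]

lemma StepFn.memLp_toFun (φ : StepFn) : MemLp φ.toFun 2 volume := by
  have : φ.toFun = fun u =>
      ∑ i, φ.coeff i * (wienerStep (φ.right i) u - wienerStep (φ.left i) u) := funext φ.toFun_eq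
  rw [this]
  exact memLp_finsetSum _ fun _ _ =>
    ((memLp_wienerStep _).sub (memLp_wienerStep _)).const_mul _

lemma StepFn.memLp_wienerIntegral (hW : IsTwoSidedWiener W P) (φ : StepFn) :
    MemLp (φ.wienerIntegral W) 2 P :=
  memLp_finsetSum _ fun _ _ => ((hW.memLp _).sub (hW.memLp _)).const_mul _

lemma StepFn.mem_wienerGraph (hW : IsTwoSidedWiener W P) (φ : StepFn) :
    (φ.memLp_toFun.toLp φ.toFun, (φ.memLp_wienerIntegral hW).toLp (φ.wienerIntegral W)) ∈
      wienerGraph hW := by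
  have : (φ.memLp_toFun.toLp φ.toFun, (φ.memLp_wienerIntegral hW).toLp (φ.wienerIntegral W)) =
      ∑ i, φ.coeff i • (((memLp_wienerStep (φ.right i)).toLp (wienerStep (φ.right i)),
        (hW.memLp (φ.right i)).toLp (W (φ.right i))) -
        ((memLp_wienerStep (φ.left i)).toLp (wienerStep (φ.left i)),
        (hW.memLp (φ.left i)).toLp (W (φ.left i)))) := by
    have h1 : φ.memLp_toFun.toLp φ.toFun = ∑ i, φ.coeff i •
        ((memLp_wienerStep (φ.right i)).toLp (wienerStep (φ.right i)) -
          (memLp_wienerStep (φ.left i)).toLp (wienerStep (φ.left i))) := by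
      simp_rw [← MemLp.toLp_sub]
      have hs := φ.memLp_toFun.ae_eq (ae_of_all _ φ.toFun_eq)
      exact (MemLp.toLp_congr _ hs (ae_of_all _ φ.toFun_eq)).trans (toLp_sum_mul _ _ _ hs)
    have h2 : (φ.memLp_wienerIntegral hW).toLp (φ.wienerIntegral W) = ∑ i, φ.coeff i •
        ((hW.memLp (φ.right i)).toLp (W (φ.right i)) -
          (hW.memLp (φ.left i)).toLp (W (φ.left i))) := by
      simp_rw [← MemLp.toLp_sub]
      exact toLp_sum_mul _ _ _ (φ.memLp_wienerIntegral hW)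
    rw [h1, h2]
    simp only [Prod.ext_iff, Prod.fst_sum, Prod.snd_sum, Prod.smul_fst, Prod.smul_snd,
      Prod.fst_sub, Prod.snd_sub, and_self]
  rw [this]
  exact Submodule.sum_mem _ fun i _ => Submodule.smul_mem _ _
    (Submodule.sub_mem _ (FracOU.mem_wienerGraph hW _) (FracOU.mem_wienerGraph hW _))

/-- Integrand and integral form a pair in the closure of the graph of the elementary integral. -/
lemma IsWienerIntegral.mem_closure (hW : IsTwoSidedWiener W P) {h : ℝ → ℝ} {X : Ω → ℝ}
    (hX : IsWienerIntegral W P h X) :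
    (hX.1.toLp h, hX.2.1.toLp X) ∈ (wienerGraph hW).topologicalClosure := by
  obtain ⟨φ, h1, h2⟩ := hX.2.2
  have e1 := (Lp.tendsto_Lp_iff_tendsto_eLpNorm'' (fun m => (φ m).toFun)
    (fun m => (φ m).memLp_toFun) h hX.1).2 h1
  have e2 := (Lp.tendsto_Lp_iff_tendsto_eLpNorm'' (fun m => (φ m).wienerIntegral W)
    (fun m => (φ m).memLp_wienerIntegral hW) X hX.2.1).2 h2
  exact mem_closure_of_tendsto (e1.prodMk_nhds e2)
    (Eventually.of_forall fun m => (φ m).mem_wienerGraph hW)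

end Wiener

/-! ### Density of step functions and existence of Wiener integrals -/

lemma integral_wienerStep_mul {f : ℝ → ℝ} (t : ℝ) :
    ∫ u, wienerStep t u * f u = ∫ u in 0..t, f u := by
  rcases le_total 0 t with ht | ht
  · rw [wienerStep_of_nonneg ht, intervalIntegral.integral_of_le ht,
      ← integral_indicator measurableSet_Ioc]
    simp [indicator_apply]
  · rw [wienerStep_of_nonpos ht, intervalIntegral.integral_of_ge ht,
      ← integral_indicator measurableSet_Ioc, ← integral_neg]
    simp [indicator_apply]

/-- The basic step functions span a dense subspace of `L²(ℝ)`. -/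
lemma topologicalClosure_span_wienerStep :
    (Submodule.span ℝ (range fun t => (memLp_wienerStep t).toLp
      (wienerStep t))).topologicalClosure = ⊤ := by
  rw [Submodule.topologicalClosure_eq_top_iff, Submodule.eq_bot_iff]
  intro f hf
  have hloc : LocallyIntegrable f volume := (Lp.memLp f).locallyIntegrable one_le_two
  -- Orthogonality to the steps kills the primitive of `f`; Lebesgue differentiation then gives `f =
  -- 0` a.e.
  have hzero : ∀ t, ∫ u in (0 : ℝ)..t, f u = 0 := by
    intro t
    have := (Submodule.mem_orthogonal _ _).1 hf _ (Submodule.subset_span (mem_range_self t))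
    rw [← Lp.toLp_coeFn f (Lp.memLp f)] at this
    rwa [inner_toLp_eq_integral_mul, integral_wienerStep_mul] at this
  refine (Lp.eq_zero_iff_ae_eq_zero).2 ?_
  filter_upwards [LocallyIntegrable.ae_hasDerivAt_integral hloc] with x hx
  have h := hx 0
  simp only [hzero] at h
  exact h.unique (hasDerivAt_const x (0 : ℝ))

/-- The sum of two step functions. -/
noncomputable def StepFn.add (φ ψ : StepFn) : StepFn where
  n := φ.n + ψ.n
  left := Fin.append φ.left ψ.left
  right := Fin.append φ.right ψ.right
  left_le_right i := by
    refine Fin.addCases (fun i => ?_) (fun i => ?_) i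
    · simpa using φ.left_le_right i
    · simpa using ψ.left_le_right i
  coeff := Fin.append φ.coeff ψ.coeff

lemma StepFn.toFun_add (φ ψ : StepFn) (u : ℝ) : (φ.add ψ).toFun u = φ.toFun u + ψ.toFun u := by
  refine (Fin.sum_univ_add _).trans ?_
  simp [StepFn.toFun, StepFn.add]

/-- A scalar multiple of a step function. -/
noncomputable def StepFn.smul (a : ℝ) (φ : StepFn) : StepFn :=
  { φ with coeff := fun i => a * φ.coeff i }

lemma StepFn.toFun_smul (a : ℝ) (φ : StepFn) (u : ℝ) : (φ.smul a).toFun u = a * φ.toFun u := by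
  simp only [StepFn.toFun, Finset.mul_sum, indicator_apply, mul_ite, mul_zero]
  rfl

/-- `IsWienerIntegral` asks for concrete step functions, so abstract elements of the span have to be
realised by such data. -/
lemma exists_stepFn_of_mem_span {f : Lp ℝ 2 (volume : Measure ℝ)}
    (hf : f ∈ Submodule.span ℝ (range fun t => (memLp_wienerStep t).toLp (wienerStep t))) :
    ∃ φ : StepFn, φ.memLp_toFun.toLp φ.toFun = f := by
  induction hf using Submodule.span_induction with
  | mem f hf =>
    obtain ⟨t, rfl⟩ := hf
    refine ⟨⟨1, fun _ => min 0 t, fun _ => max 0 t, fun _ => min_le_max,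
      fun _ => if 0 ≤ t then 1 else -1⟩, MemLp.toLp_congr _ _ (ae_of_all _ fun u => ?_)⟩
    rcases le_or_gt 0 t with ht | ht
    · simp [StepFn.toFun, wienerStep_of_nonneg ht, ht, indicator_apply]
    · simp [StepFn.toFun, wienerStep_of_nonpos ht.le, ht.le, ht.not_ge, indicator_apply]
      split_ifs <;> simp
  | zero =>
    let φ : StepFn := ⟨0, Fin.elim0, Fin.elim0, fun i => i.elim0, Fin.elim0⟩
    have hφ : φ.toFun = 0 := funext fun u => Finset.sum_eq_zero fun i _ => i.elim0
    refine ⟨φ, (Lp.eq_zero_iff_ae_eq_zero).2 ?_⟩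
    simpa only [hφ] using φ.memLp_toFun.coeFn_toLp
  | add f g _ _ hf hg =>
    obtain ⟨φ, rfl⟩ := hf
    obtain ⟨ψ, rfl⟩ := hg
    refine ⟨φ.add ψ, ?_⟩
    exact (MemLp.toLp_congr _ _ (ae_of_all _ (StepFn.toFun_add φ ψ))).trans
      (MemLp.toLp_add φ.memLp_toFun ψ.memLp_toFun)
  | smul a f _ hf =>
    obtain ⟨φ, rfl⟩ := hf
    refine ⟨φ.smul a, ?_⟩
    exact (MemLp.toLp_congr _ _ (ae_of_all _ (StepFn.toFun_smul a φ))).trans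
      (MemLp.toLp_const_smul a φ.memLp_toFun)

section Wiener

variable {Ω : Type*} [MeasurableSpace Ω] {P : Measure Ω} {W : ℝ → Ω → ℝ}

/-- Every deterministic function in `L²(ℝ)` has a Wiener integral. -/
lemma exists_isWienerIntegral (hW : IsTwoSidedWiener W P) {h : ℝ → ℝ} (hh : MemLp h 2 volume) :
    ∃ X, IsWienerIntegral W P h X := by
  have hmem : hh.toLp h ∈ (Submodule.span ℝ (range fun t => (memLp_wienerStep t).toLp
      (wienerStep t))).topologicalClosure := by
    rw [topologicalClosure_span_wienerStep]
    trivial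
  obtain ⟨f, hf, hlim⟩ := mem_closure_iff_seq_limit.1 hmem
  choose φ hφ using fun m => exists_stepFn_of_mem_span (hf m)
  set Y : ℕ → Lp ℝ 2 P := fun m =>
    ((φ m).memLp_wienerIntegral hW).toLp ((φ m).wienerIntegral W) with hY
  -- By the isometry the integrals are Cauchy because the approximants are.
  have hdist : ∀ m n, dist (Y m) (Y n) = dist (f m) (f n) := by
    intro m n
    have := norm_eq_of_mem_wienerGraph hW
      (Submodule.sub_mem _ ((φ m).mem_wienerGraph hW) ((φ n).mem_wienerGraph hW))
    rw [dist_eq_norm, dist_eq_norm, ← hφ m, ← hφ n]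
    exact this.symm
  have hcau : CauchySeq Y := by
    have hc := Metric.cauchySeq_iff.1 hlim.cauchySeq
    refine Metric.cauchySeq_iff.2 fun ε hε => ?_
    simpa only [hdist] using hc ε hε
  obtain ⟨X, hX⟩ := cauchySeq_tendsto_of_complete hcau
  refine ⟨X, hh, Lp.memLp X, φ, ?_, ?_⟩
  · refine (Lp.tendsto_Lp_iff_tendsto_eLpNorm'' (fun m => (φ m).toFun)
      (fun m => (φ m).memLp_toFun) h hh).1 ?_
    simpa only [hφ] using hlim
  · refine (Lp.tendsto_Lp_iff_tendsto_eLpNorm'' (fun m => (φ m).wienerIntegral W)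
      (fun m => (φ m).memLp_wienerIntegral hW) X (Lp.memLp X)).1 ?_
    rwa [Lp.toLp_coeFn]

/-- The law of a linear combination of Wiener integrals. -/
lemma map_sum_mul_eq_gaussianReal (hW : IsTwoSidedWiener W P) {ι : Type*} [Fintype ι] (c : ι → ℝ)
    {h : ι → ℝ → ℝ} {X : ι → Ω → ℝ} (hX : ∀ i, IsWienerIntegral W P (h i) (X i)) :
    P.map (fun ω => ∑ i, c i * X i ω) =
      gaussianReal 0 (∫ u, (∑ i, c i * h i u) ^ 2).toNNReal := by
  have h1 : MemLp (fun u => ∑ i, c i * h i u) 2 volume :=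
    memLp_finsetSum _ fun i _ => (hX i).1.const_mul _
  have h2 : MemLp (fun ω => ∑ i, c i * X i ω) 2 P :=
    memLp_finsetSum _ fun i _ => (hX i).2.1.const_mul _
  -- The closure of the graph is a subspace, so it contains the combined pair.
  have hp : (h1.toLp _, h2.toLp _) ∈ (wienerGraph hW).topologicalClosure := by
    rw [toLp_sum_mul _ _ (fun i => (hX i).1) h1, toLp_sum_mul _ _ (fun i => (hX i).2.1) h2]
    have := Submodule.sum_mem _ fun i (_ : i ∈ Finset.univ) =>
      Submodule.smul_mem _ (c i) ((hX i).mem_closure hW)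
    convert this using 1
    refine Prod.ext ?_ ?_ <;> simp [Prod.fst_sum, Prod.snd_sum]
  have := map_eq_gaussianReal_of_mem_closure hW hp
  rw [← real_inner_self_eq_norm_sq] at this
  simp only at this
  rw [inner_toLp_eq_integral_mul, Measure.map_congr h2.coeFn_toLp] at this
  simpa only [sq] using this

end Wiener

/-! ### Moving averages: Gaussianity, stationarity and marginal law -/

/-- In this form the integrands are reflected translates of a single function, so a time shift
becomes a translation in `u`. -/
lemma indicator_Iic_comp_sub (s : ℝ → ℝ) (t u : ℝ) :
    (Iic t).indicator (fun u => s (t - u)) u = (Ici 0).indicator s (t - u) := by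
  simp [indicator_apply]

lemma memLp_indicator_Ici {s : ℝ → ℝ} (hs : MemLp s 2 (volume.restrict (Ioi 0))) :
    MemLp ((Ici 0).indicator s) 2 volume := by
  rwa [memLp_indicator_iff_restrict measurableSet_Ici, ← restrict_Ioi_eq_restrict_Ici]

lemma memLp_indicator_Iic_comp_sub {s : ℝ → ℝ} (hs : MemLp s 2 (volume.restrict (Ioi 0))) (t : ℝ) :
    MemLp ((Iic t).indicator fun u => s (t - u)) 2 volume := by
  rw [funext (indicator_Iic_comp_sub s t)]
  exact (memLp_indicator_Ici hs).comp_measurePreserving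
    (Measure.measurePreserving_sub_left volume t)

lemma integral_sq_indicator_Iic_comp_sub (s : ℝ → ℝ) (t : ℝ) :
    ∫ u, (Iic t).indicator (fun u => s (t - u)) u ^ 2 = ∫ u in Ioi (0 : ℝ), s u ^ 2 := by
  simp_rw [indicator_Iic_comp_sub]
  rw [integral_sub_left_eq_self (fun u => (Ici (0 : ℝ)).indicator s u ^ 2) volume t,
    ← integral_Ici_eq_integral_Ioi, ← integral_indicator measurableSet_Ici]
  refine integral_congr_ae (ae_of_all _ fun u => ?_)
  by_cases hu : u ∈ Ici (0 : ℝ) <;> simp [hu]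

section Wiener

variable {Ω : Type*} [MeasurableSpace Ω] {P : Measure Ω} {W : ℝ → Ω → ℝ}

lemma exists_isMovingAverage (hW : IsTwoSidedWiener W P) {s : ℝ → ℝ}
    (hs : MemLp s 2 (volume.restrict (Ioi 0))) : ∃ ξ, IsMovingAverage W P s ξ := by
  choose ξ hξ using fun t => exists_isWienerIntegral hW (memLp_indicator_Iic_comp_sub hs t)
  exact ⟨ξ, hξ⟩

lemma dual_apply_eq_sum {ι : Type*} [Fintype ι] [DecidableEq ι] (L : (ι → ℝ) →L[ℝ] ℝ)
    (x : ι → ℝ) : L x = ∑ i, L (Pi.single i 1) * x i := by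
  conv_lhs => rw [pi_eq_sum_univ' x, map_sum]
  refine Finset.sum_congr rfl fun i _ => ?_
  rw [map_smul, smul_eq_mul, mul_comm]

lemma aemeasurable_pi_of_isWienerIntegral {ι : Type*} [Finite ι] {h : ι → ℝ → ℝ} {X : ι → Ω → ℝ}
    (hX : ∀ i, IsWienerIntegral W P (h i) (X i)) : AEMeasurable (fun ω i => X i ω) P :=
  have := Fintype.ofFinite ι
  aemeasurable_pi_lambda _ fun i => (hX i).2.1.aestronglyMeasurable.aemeasurable

/-- The one-dimensional projections of the joint law of finitely many Wiener integrals. -/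
lemma map_dual_map_eq_gaussianReal (hW : IsTwoSidedWiener W P) {ι : Type*} [Fintype ι]
    [DecidableEq ι] {h : ι → ℝ → ℝ} {X : ι → Ω → ℝ}
    (hX : ∀ i, IsWienerIntegral W P (h i) (X i)) (L : (ι → ℝ) →L[ℝ] ℝ) :
    (P.map fun ω i => X i ω).map L =
      gaussianReal 0 (∫ u, (∑ i, L (Pi.single i 1) * h i u) ^ 2).toNNReal := by
  rw [AEMeasurable.map_map_of_aemeasurable L.continuous.measurable.aemeasurable
    (aemeasurable_pi_of_isWienerIntegral hX), ← map_sum_mul_eq_gaussianReal hW _ hX]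
  congr 1
  funext ω
  exact dual_apply_eq_sum L _

lemma IsMovingAverage.isGaussianProcess (hW : IsTwoSidedWiener W P) {s : ℝ → ℝ} {ξ : ℝ → Ω → ℝ}
    (hξ : IsMovingAverage W P s ξ) : IsGaussianProcess ξ P where
  hasGaussianLaw I := ⟨isGaussian_of_map_eq_gaussianReal fun L =>
    ⟨_, _, map_dual_map_eq_gaussianReal hW (fun i : I => hξ i) L⟩⟩

/-- By Cramér-Wold it suffices to compare linear functionals. These are centred Gaussian, so only
their variances matter, and the substitution `u ↦ u - r` matches the variance integrals. -/
lemma IsMovingAverage.isStationary (hW : IsTwoSidedWiener W P) {s : ℝ → ℝ} {ξ : ℝ → Ω → ℝ}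
    (hξ : IsMovingAverage W P s ξ) : IsStationary ξ P := by
  intro r I
  have hP : IsProbabilityMeasure P := hW.isGaussianProcess.isProbabilityMeasure
  have h1 := aemeasurable_pi_of_isWienerIntegral fun i : I => hξ (i + r)
  have h2 := aemeasurable_pi_of_isWienerIntegral fun i : I => hξ i
  have := Measure.isProbabilityMeasure_map h1
  have := Measure.isProbabilityMeasure_map h2
  refine ⟨h1, h2, Measure.ext_of_charFunDual (funext fun L => ?_)⟩
  rw [charFunDual_eq_charFun_map_one, charFunDual_eq_charFun_map_one,
    map_dual_map_eq_gaussianReal hW (fun i : I => hξ (i + r)),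
    map_dual_map_eq_gaussianReal hW (fun i : I => hξ i)]
  simp_rw [indicator_Iic_comp_sub]
  rw [← integral_sub_right_eq_self (fun u => (∑ i : I, L (Pi.single i 1) *
    (Ici 0).indicator s (i - u)) ^ 2) r]
  simp only [sub_sub_eq_add_sub]

lemma IsMovingAverage.hasLaw (hW : IsTwoSidedWiener W P) {s : ℝ → ℝ} {ξ : ℝ → Ω → ℝ}
    (hξ : IsMovingAverage W P s ξ) (t : ℝ) :
    HasLaw (ξ t) (gaussianReal 0 (∫ u in Ioi (0 : ℝ), s u ^ 2).toNNReal) P where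
  aemeasurable := (hξ t).2.1.aestronglyMeasurable.aemeasurable
  map_eq := by
    have := map_sum_mul_eq_gaussianReal hW (fun _ : Unit => (1 : ℝ)) fun _ => hξ t
    simpa [integral_sq_indicator_Iic_comp_sub] using this

end Wiener

lemma ae_pos_of_hasLaw_gammaMeasure {Ω' : Type*} [MeasurableSpace Ω'] {P' : Measure Ω'}
    {μ lam : ℝ} {X : Ω' → ℝ} (hX : HasLaw X (gammaMeasure μ lam) P') : ∀ᵐ ω ∂P', 0 < X ω := by
  have h : ∀ᵐ x ∂gammaMeasure μ lam, 0 < x := by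
    have hm : Measurable (gammaPDF μ lam) := (measurable_gammaPDFReal μ lam).ennreal_ofReal
    rw [gammaMeasure, ae_withDensity_iff hm]
    filter_upwards [Measure.ae_ne volume (0 : ℝ)] with x hx h
    by_contra! hx'
    exact h (gammaPDF_of_neg (lt_of_le_of_ne hx' hx))
  rw [← hX.map_eq] at h
  exact ae_of_ae_map hX.aemeasurable h

end FracOU

theorem mainTheorem8
    (ρ : ℝ) (hρ : 1 / 2 < ρ) (hρ' : ρ < 2)
    {Ω' : Type*} [MeasurableSpace Ω'] (P' : Measure Ω') [IsProbabilityMeasure P']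
    {Ω : Type*} [MeasurableSpace Ω] (P : Measure Ω) [IsProbabilityMeasure P]
    (μ lam : ℝ) (hμ : 0 < μ) (hlam : 0 < lam)
    (α : ℕ → Ω' → ℝ) (hα_indep : iIndepFun α P')
    (hα_law : ∀ k, HasLaw (α k) (gammaMeasure μ lam) P')
    (W : ℝ → Ω → ℝ) (hW : FracOU.IsTwoSidedWiener W P) :
    (∀ a : ℝ, 0 < a → ∀ f : ℝ → ℝ,
      FracOU.IsScalarResolvent ρ a f ↔ EqOn f (FracOU.scalarResolvent ρ a) (Ici 0)) ∧
    (∃ c : ℝ, 0 < c ∧ ∀ a : ℝ, 0 < a →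
      MemLp (FracOU.scalarResolvent ρ a) 2 (volume.restrict (Ioi 0)) ∧
      ∫ t in Ioi (0 : ℝ), FracOU.scalarResolvent ρ a t ^ 2 ≤ c * a ^ (-(1 / ρ))) ∧
    (∀ᵐ ω' ∂P', ∀ k : ℕ,
      0 < α k ω' ∧
      (∃ ξ : ℝ → Ω → ℝ,
        FracOU.IsMovingAverage W P (FracOU.scalarResolvent ρ (α k ω')) ξ) ∧
      (∀ ξ : ℝ → Ω → ℝ,
        FracOU.IsMovingAverage W P (FracOU.scalarResolvent ρ (α k ω')) ξ →
        IsGaussianProcess ξ P ∧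
        FracOU.IsStationary ξ P ∧
        ∀ t : ℝ, HasLaw (ξ t)
          (gaussianReal 0
            (∫ u in Ioi (0 : ℝ), FracOU.scalarResolvent ρ (α k ω') u ^ 2).toNNReal) P)) := by
  refine ⟨fun a ha f => FracOU.isScalarResolvent_iff (by linarith) ha f,
    FracOU.exists_scalarResolvent_memLp_bound hρ hρ',
    -- There are countably many `k`, and positivity of `α k` is the only almost sure input; the rest
    -- holds for each fixed positive value.
    ae_all_iff.2 fun k => ?_⟩
  obtain ⟨c, -, hc⟩ := FracOU.exists_scalarResolvent_memLp_bound hρ hρ'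
  filter_upwards [FracOU.ae_pos_of_hasLaw_gammaMeasure (hα_law k)] with ω' h
  exact ⟨h, FracOU.exists_isMovingAverage hW (hc _ h).1, fun ξ hξ =>
    ⟨hξ.isGaussianProcess hW, hξ.isStationary hW, hξ.hasLaw hW⟩⟩
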